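/- Let $\mathbb S^3\times\mathbb R=\{(x_1,\dots,x_5)\in\mathbb E^5 : x_1^2+x_2^2+x_3^2+x_4^2=1\}$, let $M$ be a smooth $3$-manifold and $x:M\to\mathbb S^3\times\mathbb R\subset\mathbb E^5$ a smooth immersed hypersurface, oriented by a smooth unit normal vector field $N$ (tangent to $\mathbb S^3\times\mathbb R$), with shape operator $S$. Let $T$ be the tangential component of $\partial/\partial x_5$, i.e. $\partial/\partial x_5=T+\sigma N$ along $M$ with $T$ tangent to $M$, and assume that $T$ vanishes nowhere. Suppose that $M$ has three principal curvatures $k_1,k_2,k_3$ that are distinct at every point, that $ST=k_1T$, and that there are functions $f_1,f_2:\mathbb R\to\mathbb R$ with $k_2=f_1(k_1)$ and $k_3=f_2(k_1)$ on $M$. Then $M$ is locally congruent to a hypersurface of the form $$(s,v,w)\mapsto\bigl(\cos\alpha_1(s)\cos v,\ \cos\alpha_1(s)\sin v,\ \sin\alpha_1(s)\cos w,\ \sin\alpha_1(s)\sin w,\ \alpha_2(s)\bigr),$$ where $\alpha_1,\alpha_2$ are smooth functions on an open interval $I$ with $\alpha_1'^2+\alpha_2'^2=1$, $\cos\alpha_1>0$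 and $\sin\alpha_1>0$. That is, every point of $M$ has a neighbourhood with smooth local coordinates $(s,v,w)$, $s\in I$, in which the composition of $x$ with a suitable isometry of $\mathbb S^3\times\mathbb R$ is the map above for some such $I,\alpha_1,\alpha_2$. -/

import Mathlib

open scoped Manifold ContDiff

noncomputable section

namespace S3R

/-- The Euclidean space `𝔼ⁿ`. -/
abbrev E (n : ℕ) : Type := EuclideanSpace ℝ (Fin n)

/-- `𝕊³ × ℝ ⊂ 𝔼⁵`. The last coordinate (index `4`) is the `ℝ`-factor. -/
def product : Set (E 5) := {y | y 0 ^ 2 + y 1 ^ 2 + y 2 ^ 2 + y 3 ^ 2 = 1}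

/-- The unit normal of `𝕊³ × ℝ` in `𝔼⁵` at the point `y`. -/
def outerNormal (y : E 5) : E 5 := !₂[y 0, y 1, y 2, y 3, 0]

/-- The unit vector `∂/∂t` tangent to the `ℝ`-factor. -/
def dt : E 5 := !₂[0, 0, 0, 0, 1]

section Hypersurface

variable {M : Type*} [TopologicalSpace M] [ChartedSpace (E 3) M]

/-- The differential at `p` of a map from a `3`-manifold to `𝔼⁵`. -/
def diff (f : M → E 5) (p : M) : TangentSpace (𝓡 3) p →L[ℝ] E 5 :=
  mfderiv (𝓡 3) 𝓘(ℝ, E 5) f p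

/-- `x : M → 𝕊³ × ℝ ⊂ 𝔼⁵` is a smooth immersed hypersurface, oriented by the smooth unit normal
vector field `N`, which is tangent to `𝕊³ × ℝ` and orthogonal to `M`. -/
structure IsOrientedHypersurface (x N : M → E 5) : Prop where
  smooth : ContMDiff (𝓡 3) 𝓘(ℝ, E 5) ∞ x
  immersion : ∀ p, Function.Injective (diff x p)
  mem_product : ∀ p, x p ∈ product
  smooth_normal : ContMDiff (𝓡 3) 𝓘(ℝ, E 5) ∞ N
  norm_normal : ∀ p, ‖N p‖ = 1
  normal_tangent_product : ∀ p, inner ℝ (N p) (outerNormal (x p)) = 0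
  normal_orthogonal : ∀ p (X : TangentSpace (𝓡 3) p), inner ℝ (N p) (diff x p X) = 0

/-- The component of a vector of `𝔼⁵` tangent to the immersed hypersurface `x` at `p`, as an
element of the tangent space of `M`: orthogonal projection to the image of the (injective)
differential of `x`, followed by the inverse of the differential. -/
def tangentPart (x : M → E 5) (p : M) : E 5 →ₗ[ℝ] TangentSpace (𝓡 3) p :=
  (diff x p).toLinearMap.leftInverse ∘ₗ
    ((LinearMap.range (diff x p).toLinearMap).starProjection : E 5 →L[ℝ] E 5).toLinearMap

/-- For an immersion, `tangentPart x p v` is the tangent vector whose image under the differential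
is the orthogonal projection of `v`. -/
theorem diff_tangentPart {x : M → E 5} {p : M} (h : Function.Injective (diff x p)) (v : E 5) :
    diff x p (tangentPart x p v) =
      (LinearMap.range (diff x p).toLinearMap).starProjection v := by
  obtain ⟨X, hX⟩ :=
    (LinearMap.range (diff x p).toLinearMap).starProjection_apply_mem v
  have hk : LinearMap.ker (diff x p).toLinearMap = ⊥ := LinearMap.ker_eq_bot.2 h
  have h2 : tangentPart x p v = X := by
    change (diff x p).toLinearMap.leftInverse
      ((LinearMap.range (diff x p).toLinearMap).starProjection v) = X
    rw [← hX]
    exact LinearMap.leftInverse_apply_of_inj hk X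
  rw [h2]
  exact hX

/-- The shape operator of `M` in `𝕊³ × ℝ` with respect to `N`: by the Weingarten formula
`S X = - ∇̃_X N`, where `∇̃_X N` is tangent to `M`, hence equal to the component tangent to `M` of
the derivative of `N` in `𝔼⁵`. -/
def shapeOperator (x N : M → E 5) (p : M) : Module.End ℝ (TangentSpace (𝓡 3) p) :=
  -(tangentPart x p ∘ₗ (diff N p).toLinearMap)

/-- The tangential component `T` of `∂/∂t`, that is, `∂/∂t = T + σ N`. -/
def heightField (x : M → E 5) (p : M) : TangentSpace (𝓡 3) p := tangentPart x p dt

end Hypersurface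

/-- The map `(s, v, w) ↦ (cos α₁ cos v, cos α₁ sin v, sin α₁ cos w, sin α₁ sin w, α₂)`, with
`α₁, α₂` evaluated at `s`. -/
def torusMap (α₁ α₂ : ℝ → ℝ) (y : E 3) : E 5 :=
  !₂[Real.cos (α₁ (y 0)) * Real.cos (y 1), Real.cos (α₁ (y 0)) * Real.sin (y 1),
    Real.sin (α₁ (y 0)) * Real.cos (y 2), Real.sin (α₁ (y 0)) * Real.sin (y 2), α₂ (y 0)]

/-- Admissible data `α₁, α₂` for `torusMap`, on an open interval `I`. -/
structure IsProfile (I : Set ℝ) (α₁ α₂ : ℝ → ℝ) : Prop where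
  isOpen : IsOpen I
  interval : I.OrdConnected
  smooth_left : ContDiffOn ℝ ∞ α₁ I
  smooth_right : ContDiffOn ℝ ∞ α₂ I
  unit_speed : ∀ s ∈ I, deriv α₁ s ^ 2 + deriv α₂ s ^ 2 = 1
  cos_pos : ∀ s ∈ I, 0 < Real.cos (α₁ s)
  sin_pos : ∀ s ∈ I, 0 < Real.sin (α₁ s)

/-- `x` is locally congruent to a hypersurface of the family `torusMap`: around each point `p` there
are a smooth chart `φ = (s, v, w)` of `M`, an isometry `Φ` of `𝕊³ × ℝ` (the restriction of an
isometry of `𝔼⁵`) and admissible `α₁, α₂` such that `Φ ∘ x` is `torusMap α₁ α₂` in these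
coordinates. -/
def LocallyCongruentToTorusMap {M : Type*} [TopologicalSpace M] [ChartedSpace (E 3) M]
    (x : M → E 5) : Prop :=
  ∀ p : M, ∃ (φ : OpenPartialHomeomorph M (E 3)) (Φ : E 5 ≃ᵃⁱ[ℝ] E 5) (I : Set ℝ) (α₁ α₂ : ℝ → ℝ),
    φ ∈ IsManifold.maximalAtlas (𝓡 3) ∞ M ∧ p ∈ φ.source ∧
    Φ '' product = product ∧ IsProfile I α₁ α₂ ∧
    ∀ q ∈ φ.source, φ q 0 ∈ I ∧ Φ (x q) = torusMap α₁ α₂ (φ q)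

end S3R

end

/-!
The symmetry of the second fundamental form together with `S T = k₁ T` gives `dσ = -k₁ dh` for the
height `h` and the angle function `σ`. Since `dh ≠ 0`, `σ` and hence `k₁`, `k₂`, `k₃` are locally
functions of `h`, and the slices `h = const` are parallel surfaces in `𝕊³` of a single surface with
two distinct constant principal curvatures. Writing these curvatures as `cot` of angles, the two
focal maps `A`, `B` of that surface have independent values and constant inner product, so they
trace circles in orthogonal planes. The slice at height `h` is therefore
`cos (φ + β h) • A + sin (φ + β h) • B`, and an arclength parameter of `h ↦ (φ + β h, h)` yields the
profile.
-/

namespace S3R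

section Analysis

variable {F G H : Type*} [NormedAddCommGroup F] [NormedSpace ℝ F]
  [NormedAddCommGroup G] [NormedSpace ℝ G] [NormedAddCommGroup H] [NormedSpace ℝ H]

theorem hasFDerivAt_of_contDiffOn {f : F → G} {U : Set F} (hU : IsOpen U) (hf : ContDiffOn ℝ ∞ f U)
    {z : F} (hz : z ∈ U) : HasFDerivAt f (fderiv ℝ f z) z :=
  (hf.differentiableOn (by simp)).hasFDerivAt (hU.mem_nhds hz)

theorem isOpen_setOf_fderiv_mem_range_equiv [CompleteSpace F] {f : F → G} {U : Set F}
    (hU : IsOpen U) (hf : ContDiffOn ℝ ∞ f U) :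
    IsOpen (U ∩ fderiv ℝ f ⁻¹' Set.range ((↑) : (F ≃L[ℝ] G) → F →L[ℝ] G)) :=
  (hf.continuousOn_fderiv_of_isOpen hU (by simp)).isOpen_inter_preimage hU
    ContinuousLinearEquiv.isOpen

theorem exists_openPartialHomeomorph_of_injective_fderiv [FiniteDimensional ℝ F]
    [FiniteDimensional ℝ G] (hdim : Module.finrank ℝ F = Module.finrank ℝ G) {f : F → G}
    {U : Set F} (hU : IsOpen U) (hf : ContDiffOn ℝ ∞ f U) {a : F} (ha : a ∈ U)
    (hinj : Function.Injective (fderiv ℝ f a)) :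
    ∃ ψ : OpenPartialHomeomorph F G, a ∈ ψ.source ∧ ψ.source ⊆ U ∧ ψ = f ∧
      ContDiffOn ℝ ∞ ψ.symm ψ.target := by
  have : CompleteSpace F := FiniteDimensional.complete ℝ F
  have hsmooth : ∀ z ∈ U, ContDiffAt ℝ ∞ f z := fun z hz => hf.contDiffAt (hU.mem_nhds hz)
  let e : F ≃L[ℝ] G :=
    (LinearEquiv.ofInjectiveOfFinrankEq (fderiv ℝ f a).toLinearMap hinj
      hdim).toContinuousLinearEquiv
  have he : (e : F →L[ℝ] G) = fderiv ℝ f a := rfl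
  have hda : HasFDerivAt f (e : F →L[ℝ] G) a := hasFDerivAt_of_contDiffOn hU hf ha
  refine ⟨((hsmooth a ha).toOpenPartialHomeomorph f hda (by simp)).restrOpen _
      (isOpen_setOf_fderiv_mem_range_equiv hU hf),
    ⟨(hsmooth a ha).mem_toOpenPartialHomeomorph_source hda (by simp), ha, e, he⟩,
    fun z hz => hz.2.1, rfl, fun y hy => ContDiffAt.contDiffWithinAt ?_⟩
  obtain ⟨-, hzU, e', he'⟩ := OpenPartialHomeomorph.map_target _ hy
  refine OpenPartialHomeomorph.contDiffAt_symm _ (f₀' := e') hy ?_ (hsmooth _ hzU)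
  rw [he']
  exact hasFDerivAt_of_contDiffOn hU hf hzU

theorem exists_openPartialHomeomorph_target_eq_ball [FiniteDimensional ℝ F]
    [FiniteDimensional ℝ G] (hdim : Module.finrank ℝ F = Module.finrank ℝ G) {f : F → G}
    {U : Set F} (hU : IsOpen U) (hf : ContDiffOn ℝ ∞ f U) {a : F} (ha : a ∈ U)
    (hinj : Function.Injective (fderiv ℝ f a)) :
    ∃ (ψ : OpenPartialHomeomorph F G) (ε : ℝ), 0 < ε ∧ a ∈ ψ.source ∧ ψ.source ⊆ U ∧
      ψ = f ∧ ψ.target = Metric.ball (f a) ε ∧ ContDiffOn ℝ ∞ ψ.symm ψ.target := by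
  obtain ⟨ψ, ha', hψU, hψ, hsymm⟩ :=
    exists_openPartialHomeomorph_of_injective_fderiv hdim hU hf ha hinj
  have hfa : f a ∈ ψ.target := hψ ▸ ψ.map_source ha'
  obtain ⟨ε, hε, hball⟩ := Metric.isOpen_iff.1 ψ.open_target _ hfa
  refine ⟨(ψ.symm.restrOpen _ (Metric.isOpen_ball (x := f a) (ε := ε))).symm, ε, hε,
    ?_, ?_, hψ, ?_, ?_⟩
  · simp [ha', hψ, hε]
  · exact fun z hz => hψU hz.1
  · exact Set.inter_eq_right.2 hball
  · exact hsymm.mono fun y hy => hy.1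

theorem fderiv_comp_symm_apply {ψ : OpenPartialHomeomorph F G} {f : F → H}
    (hψ : ContDiffOn ℝ ∞ ψ ψ.source) (hsymm : ContDiffOn ℝ ∞ ψ.symm ψ.target)
    (hf : ContDiffOn ℝ ∞ f ψ.source) {z : F} (hz : z ∈ ψ.source) (X : F) :
    fderiv ℝ (f ∘ ψ.symm) (ψ z) (fderiv ℝ ψ z X) = fderiv ℝ f z X := by
  have heq : (f ∘ ψ.symm) ∘ ψ =ᶠ[nhds z] f := by
    filter_upwards [ψ.open_source.mem_nhds hz] with y hy using congrArg f (ψ.left_inv hy)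
  have hdψ := hasFDerivAt_of_contDiffOn ψ.open_source hψ hz
  have hdf := hasFDerivAt_of_contDiffOn ψ.open_target (hf.comp hsymm ψ.mapsTo_symm)
    (ψ.map_source hz)
  rw [← heq.fderiv_eq, (hdf.comp z hdψ).fderiv, ContinuousLinearMap.comp_apply]

theorem fderiv_comp_symm_eq_zero {ψ : OpenPartialHomeomorph F G} {f : F → H}
    (hψ : ContDiffOn ℝ ∞ ψ ψ.source) (hsymm : ContDiffOn ℝ ∞ ψ.symm ψ.target)
    (hf : ContDiffOn ℝ ∞ f ψ.source) {y : G} (hy : y ∈ ψ.target) {Y : G}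
    (h0 : ∀ X, fderiv ℝ ψ (ψ.symm y) X = Y → fderiv ℝ f (ψ.symm y) X = 0) :
    fderiv ℝ (f ∘ ψ.symm) y Y = 0 := by
  have hY : fderiv ℝ ψ (ψ.symm y) (fderiv ℝ ψ.symm y Y) = Y := by
    simpa using fderiv_comp_symm_apply (ψ := ψ.symm) hsymm hψ contDiffOn_id hy Y
  rw [← h0 _ hY, ← fderiv_comp_symm_apply hψ hsymm hf (ψ.map_target hy), hY, ψ.right_inv hy]

theorem eq_of_fderiv_eq_zero_on_segment {f : F → G} {y z : F}
    (hf : ∀ p ∈ segment ℝ y z, DifferentiableAt ℝ f p)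
    (h0 : ∀ p ∈ segment ℝ y z, fderiv ℝ f p (z - y) = 0) : f z = f y := by
  rw [segment_eq_image', Set.forall_mem_image] at hf h0
  have hderiv : ∀ t ∈ Set.Icc (0 : ℝ) 1, HasDerivAt (fun t : ℝ => f (y + t • (z - y))) 0 t := by
    intro t ht
    have hline : HasDerivAt (fun t : ℝ => y + t • (z - y)) (z - y) t := by
      simpa using ((hasDerivAt_id t).smul_const (z - y)).const_add y
    have hcomp := (hf ht).hasFDerivAt.comp_hasDerivAt t hline
    rwa [h0 ht] at hcomp
  simpa using constant_of_has_deriv_right_zero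
    (fun t ht => (hderiv t ht).continuousAt.continuousWithinAt)
    (fun t ht => (hderiv t ⟨ht.1, ht.2.le⟩).hasDerivWithinAt) 1 (by simp)

theorem exists_openPartialHomeomorph_fst_eq [FiniteDimensional ℝ F] [FiniteDimensional ℝ G]
    {h : F → G} {U : Set F} (hU : IsOpen U) (hh : ContDiffOn ℝ ∞ h U) {a : F} (ha : a ∈ U)
    (hsurj : Function.Surjective (fderiv ℝ h a)) :
    ∃ (K : Submodule ℝ F) (ψ : OpenPartialHomeomorph F (G × K)) (ε : ℝ), 0 < ε ∧
      a ∈ ψ.source ∧ ψ.source ⊆ U ∧ (∀ z, (ψ z).1 = h z) ∧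
      ψ.target = Metric.ball (h a) ε ×ˢ Metric.ball (ψ a).2 ε ∧
      ContDiffOn ℝ ∞ ψ ψ.source ∧ ContDiffOn ℝ ∞ ψ.symm ψ.target := by
  let K := LinearMap.ker (fderiv ℝ h a).toLinearMap
  obtain ⟨π, hπ⟩ : ∃ π : F →L[ℝ] K, ∀ X : K, π X = X :=
    Submodule.ClosedComplemented.of_finiteDimensional K
  have hdh : HasFDerivAt h (fderiv ℝ h a) a := hasFDerivAt_of_contDiffOn hU hh ha
  let Ψ : F → G × K := fun z => (h z, π z)
  have hΨ : ContDiffOn ℝ ∞ Ψ U := hh.prodMk π.contDiff.contDiffOn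
  have hdim : Module.finrank ℝ F = Module.finrank ℝ (G × K) := by
    rw [Module.finrank_prod, ← (fderiv ℝ h a).toLinearMap.finrank_range_add_finrank_ker,
      LinearMap.range_eq_top.2 hsurj, finrank_top]
  have hinj : Function.Injective (fderiv ℝ Ψ a) := by
    refine (injective_iff_map_eq_zero _).2 fun X hX => ?_
    rw [(hdh.prodMk π.hasFDerivAt).fderiv, ContinuousLinearMap.prod_apply, Prod.mk_eq_zero] at hX
    exact (Submodule.mk_eq_zero K hX.1).1 ((hπ ⟨X, hX.1⟩).symm.trans hX.2)
  obtain ⟨ψ, ε, hε, haψ, hψU, hψ, htarget, hsymm⟩ :=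
    exists_openPartialHomeomorph_target_eq_ball hdim hU hΨ ha hinj
  refine ⟨K, ψ, ε, hε, haψ, hψU, fun z => by rw [hψ], ?_, hψ ▸ hΨ.mono hψU, hsymm⟩
  rw [htarget, hψ, ball_prod_same]

theorem exists_eventually_eq_comp_of_ker_fderiv_le [FiniteDimensional ℝ F] [FiniteDimensional ℝ G]
    {f : F → H} {h : F → G} {U : Set F} (hU : IsOpen U) (hf : ContDiffOn ℝ ∞ f U)
    (hh : ContDiffOn ℝ ∞ h U) {a : F} (ha : a ∈ U) (hsurj : Function.Surjective (fderiv ℝ h a))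
    (hker : ∀ z ∈ U, ∀ X, fderiv ℝ h z X = 0 → fderiv ℝ f z X = 0) :
    ∃ (ε : ℝ) (g : G → H), 0 < ε ∧ ContDiffOn ℝ ∞ g (Metric.ball (h a) ε) ∧
      ∀ᶠ z in nhds a, h z ∈ Metric.ball (h a) ε ∧ f z = g (h z) := by
  obtain ⟨K, ψ, ε, hε, haψ, hψU, hψ, htarget, hsmooth, hsymm⟩ :=
    exists_openPartialHomeomorph_fst_eq hU hh ha hsurj
  have hcomp : ContDiffOn ℝ ∞ (f ∘ ψ.symm) ψ.target :=
    hf.comp hsymm fun y hy => hψU (ψ.map_target hy)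
  have hfst : ∀ y ∈ ψ.source, ∀ X, (fderiv ℝ ψ y X).1 = fderiv ℝ h y X := fun y hy X => by
    have hdψ := (hasFDerivAt_of_contDiffOn ψ.open_source hsmooth hy).fst
    rw [show h = fun z => (ψ z).1 from funext fun z => (hψ z).symm, hdψ.fderiv]
    rfl
  have hslice : ∀ y ∈ Metric.ball (h a) ε, (y, (ψ a).2) ∈ ψ.target := fun y hy => by
    rw [htarget]
    exact ⟨hy, Metric.mem_ball_self hε⟩
  refine ⟨ε, fun y => f (ψ.symm (y, (ψ a).2)), hε,
    hcomp.comp (contDiffOn_id.prodMk contDiffOn_const) hslice, ?_⟩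
  filter_upwards [ψ.open_source.mem_nhds haψ] with z hz
  have hzt := ψ.map_source hz
  have hhz : h z ∈ Metric.ball (h a) ε := by
    rw [htarget] at hzt
    exact hψ z ▸ hzt.1
  refine ⟨hhz, ?_⟩
  have hseg : segment ℝ (h z, (ψ a).2) (ψ z) ⊆ ψ.target := by
    have hconv : Convex ℝ ψ.target := htarget ▸ (convex_ball _ _).prod (convex_ball _ _)
    exact hconv.segment_subset (hslice _ hhz) hzt
  have heq := eq_of_fderiv_eq_zero_on_segment (f := f ∘ ψ.symm)
    (fun p hp => (hasFDerivAt_of_contDiffOn ψ.open_target hcomp (hseg hp)).differentiableAt)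
    (fun p hp => fderiv_comp_symm_eq_zero hsmooth hsymm (hf.mono hψU) (hseg hp) fun X hX => by
      refine hker _ (hψU (ψ.map_target (hseg hp))) X ?_
      rw [← hfst _ (ψ.map_target (hseg hp)), hX, Prod.fst_sub, hψ, sub_self])
  rwa [Function.comp_apply, ψ.left_inv hz] at heq

theorem eq_zero_of_forall_apply_eq_zero {ι F : Type*} [Fintype ι] [AddCommGroup F] [Module ℝ F]
    [FiniteDimensional ℝ F] (hcard : Fintype.card ι = Module.finrank ℝ F) {f : ι → F →ₗ[ℝ] ℝ}
    {e : ι → F} (hdiag : ∀ i, f i (e i) ≠ 0) (hoff : ∀ i j, i ≠ j → f i (e j) = 0) {X : F}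
    (hX : ∀ i, f i X = 0) : X = 0 := by
  classical
  have hcoord : ∀ g : ι → ℝ, ∀ i, f i (∑ j, g j • e j) = g i * f i (e i) := fun g i => by
    rw [map_sum, Finset.sum_eq_single i (fun j _ hj => by simp [hoff i j hj.symm]) (by simp),
      map_smul, smul_eq_mul]
  have hli : LinearIndependent ℝ e := Fintype.linearIndependent_iff.2 fun g hg i =>
    (mul_eq_zero.1 ((hcoord g i).symm.trans (by rw [hg, map_zero]))).resolve_right (hdiag i)
  have hX_mem : X ∈ Submodule.span ℝ (Set.range e) :=
    hli.span_eq_top_of_card_eq_finrank' hcard ▸ Submodule.mem_top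
  obtain ⟨g, rfl⟩ := (Submodule.mem_span_range_iff_exists_fun ℝ).1 hX_mem
  have hg : g = 0 := funext fun i =>
    (mul_eq_zero.1 ((hcoord g i).symm.trans (hX i))).resolve_right (hdiag i)
  simp [hg]

theorem exists_forall_eq_zero_of_three_directions
    (hdim : Module.finrank ℝ F = 3) {a : F →L[ℝ] ℝ} {b : F →L[ℝ] G} {c : F →L[ℝ] H}
    (ha : ∃ e, a e ≠ 0 ∧ b e = 0 ∧ c e = 0) (hb : ∃ e, a e = 0 ∧ b e ≠ 0 ∧ c e = 0)
    (hc : ∃ e, a e = 0 ∧ b e = 0 ∧ c e ≠ 0) :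
    ∃ (l : G →L[ℝ] ℝ) (m : H →L[ℝ] ℝ), ∀ X, a X = 0 → l (b X) = 0 → m (c X) = 0 → X = 0 := by
  have : FiniteDimensional ℝ F := .of_finrank_pos (by omega)
  obtain ⟨e₁, ha₁, hb₁, hc₁⟩ := ha
  obtain ⟨e₂, ha₂, hb₂, hc₂⟩ := hb
  obtain ⟨e₃, ha₃, hb₃, hc₃⟩ := hc
  obtain ⟨l, hl⟩ := SeparatingDual.exists_ne_zero (R := ℝ) hb₂
  obtain ⟨m, hm⟩ := SeparatingDual.exists_ne_zero (R := ℝ) hc₃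
  refine ⟨l, m, fun X h₁ h₂ h₃ => eq_zero_of_forall_apply_eq_zero (by simp [hdim])
    (f := ![a.toLinearMap, (l ∘L b).toLinearMap, (m ∘L c).toLinearMap]) (e := ![e₁, e₂, e₃])
    (fun i => ?_) (fun i j => ?_) fun i => ?_⟩
  · fin_cases i <;> simpa
  · fin_cases i <;> fin_cases j <;> simp [*]
  · fin_cases i <;> simpa

theorem eq_of_fderiv_eq_zero_of_convex {T : Set (F × G)} (hT : IsOpen T) (hconv : Convex ℝ T)
    {g : F × G → H} (hg : ContDiffOn ℝ ∞ g T) {s₀ s : F} {u d : G}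
    (hfst : ∀ p ∈ T, ∀ X, fderiv ℝ g p (X, 0) = 0)
    (hsnd : ∀ p ∈ T, p.1 = s₀ → fderiv ℝ g p (0, d) = 0) (h₁ : (s, u) ∈ T) (h₂ : (s₀, u) ∈ T)
    (h₃ : (s₀, u + d) ∈ T) : g (s, u) = g (s₀, u + d) := by
  have hdiff : ∀ p ∈ T, DifferentiableAt ℝ g p := fun p hp =>
    (hasFDerivAt_of_contDiffOn hT hg hp).differentiableAt
  have hseg₁ := hconv.segment_subset h₂ h₁
  have hseg₂ := hconv.segment_subset h₂ h₃
  trans g (s₀, u)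
  · refine eq_of_fderiv_eq_zero_on_segment (fun p hp => hdiff p (hseg₁ hp)) fun p hp => ?_
    rw [Prod.mk_sub_mk, sub_self]
    exact hfst p (hseg₁ hp) _
  · refine (eq_of_fderiv_eq_zero_on_segment (fun p hp => hdiff p (hseg₂ hp)) fun p hp => ?_).symm
    rw [Prod.mk_sub_mk, sub_self, add_sub_cancel_left]
    refine hsnd p (hseg₂ hp) ?_
    obtain ⟨t, -, rfl⟩ := (segment_eq_image' ℝ (s₀, u) (s₀, u + d)).subset hp
    simp

theorem fderiv_comp_symm_eq_zero_of_smul {ψ : OpenPartialHomeomorph F G} {f : F → H}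
    (hψ : ContDiffOn ℝ ∞ ψ ψ.source) (hsymm : ContDiffOn ℝ ∞ ψ.symm ψ.target)
    (hf : ContDiffOn ℝ ∞ f ψ.source) {z X : F} (hz : z ∈ ψ.source) {r : ℝ} {Y : G} (hX : X ≠ 0)
    (hXY : fderiv ℝ ψ z X = r • Y) (h0 : fderiv ℝ f z X = 0) :
    fderiv ℝ (f ∘ ψ.symm) (ψ z) Y = 0 := by
  have hr : r ≠ 0 := fun hr => hX <| by
    simpa [hXY, hr] using (fderiv_comp_symm_apply hψ hsymm contDiffOn_id hz X).symm
  rw [← fderiv_comp_symm_apply hψ hsymm hf hz, hXY, map_smul] at h0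
  exact (smul_eq_zero.1 h0).resolve_left hr

/-- The first coordinate can be moved to `s₀` freely; on the slice where it equals `s₀`, so can the
component of the second one along `d`. -/
theorem comp_symm_eq_comp_symm_add {ψ : OpenPartialHomeomorph F (ℝ × G)} {f : F → H}
    (hψ : ContDiffOn ℝ ∞ ψ ψ.source) (hsymm : ContDiffOn ℝ ∞ ψ.symm ψ.target)
    (hconv : Convex ℝ ψ.target) (hf : ContDiffOn ℝ ∞ f ψ.source) {s₀ : ℝ} {d : G}
    (hfst : ∀ z ∈ ψ.source, ∃ (e : F) (r : ℝ),
      e ≠ 0 ∧ fderiv ℝ ψ z e = r • (1, 0) ∧ fderiv ℝ f z e = 0)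
    (hsnd : ∀ z ∈ ψ.source, (ψ z).1 = s₀ → ∃ (e : F) (r : ℝ),
      e ≠ 0 ∧ fderiv ℝ ψ z e = r • (0, d) ∧ fderiv ℝ f z e = 0)
    {s r : ℝ} {u : G} (h₁ : (s, u) ∈ ψ.target) (h₂ : (s₀, u) ∈ ψ.target)
    (h₃ : (s₀, u + r • d) ∈ ψ.target) :
    f (ψ.symm (s, u)) = f (ψ.symm (s₀, u + r • d)) := by
  refine eq_of_fderiv_eq_zero_of_convex ψ.open_target hconv (hf.comp hsymm ψ.mapsTo_symm)
    (fun p hp X => ?_) (fun p hp hps => ?_) h₁ h₂ h₃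
  · obtain ⟨e, c, he, hc, hfe⟩ := hfst _ (ψ.map_target hp)
    have h0 := fderiv_comp_symm_eq_zero_of_smul hψ hsymm hf (ψ.map_target hp) he hc hfe
    rw [ψ.right_inv hp] at h0
    rw [show ((X, 0) : ℝ × G) = X • (1, 0) by simp, map_smul, h0, smul_zero]
  · obtain ⟨e, c, he, hc, hfe⟩ := hsnd _ (ψ.map_target hp) (by rw [ψ.right_inv hp, hps])
    have h0 := fderiv_comp_symm_eq_zero_of_smul hψ hsymm hf (ψ.map_target hp) he hc hfe
    rw [ψ.right_inv hp] at h0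
    rw [show ((0, r • d) : ℝ × G) = r • (0, d) by simp, map_smul, h0, smul_zero]

theorem exists_openPartialHomeomorph_prod_prod
    (hdim : Module.finrank ℝ F = 3) {O : Set F} (hO : IsOpen O) {q : F} (hq : q ∈ O) {h : F → ℝ}
    {V : F → G} {W : F → H} (hh : ContDiffOn ℝ ∞ h O) (hV : ContDiffOn ℝ ∞ V O)
    (hW : ContDiffOn ℝ ∞ W O)
    (h₁ : ∃ e, fderiv ℝ h q e ≠ 0 ∧ fderiv ℝ V q e = 0 ∧ fderiv ℝ W q e = 0)
    (h₂ : ∃ e, fderiv ℝ h q e = 0 ∧ fderiv ℝ V q e ≠ 0 ∧ fderiv ℝ W q e = 0)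
    (h₃ : ∃ e, fderiv ℝ h q e = 0 ∧ fderiv ℝ V q e = 0 ∧ fderiv ℝ W q e ≠ 0) :
    ∃ (l : G →L[ℝ] ℝ) (m : H →L[ℝ] ℝ) (ψ : OpenPartialHomeomorph F (ℝ × ℝ × ℝ)) (ε : ℝ), 0 < ε ∧
      q ∈ ψ.source ∧ ψ.source ⊆ O ∧ (∀ z, ψ z = (h z, l (V z), m (W z))) ∧
      (∀ z ∈ ψ.source, ∀ X,
        fderiv ℝ ψ z X = (fderiv ℝ h z X, l (fderiv ℝ V z X), m (fderiv ℝ W z X))) ∧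
      ψ.target = Metric.ball (h q) ε ×ˢ Metric.ball (l (V q)) ε ×ˢ Metric.ball (m (W q)) ε ∧
      ContDiffOn ℝ ∞ ψ ψ.source ∧ ContDiffOn ℝ ∞ ψ.symm ψ.target := by
  have : FiniteDimensional ℝ F := .of_finrank_pos (by omega)
  obtain ⟨l, m, hlm⟩ := exists_forall_eq_zero_of_three_directions hdim h₁ h₂ h₃
  let Ψ : F → ℝ × ℝ × ℝ := fun z => (h z, l (V z), m (W z))
  have hdΨ : ∀ z ∈ O, ∀ X,
      fderiv ℝ Ψ z X = (fderiv ℝ h z X, l (fderiv ℝ V z X), m (fderiv ℝ W z X)) := by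
    intro z hz X
    have hdh := hasFDerivAt_of_contDiffOn hO hh hz
    have hdV := l.hasFDerivAt.comp z (hasFDerivAt_of_contDiffOn hO hV hz)
    have hdW := m.hasFDerivAt.comp z (hasFDerivAt_of_contDiffOn hO hW hz)
    exact DFunLike.congr_fun (hdh.prodMk (hdV.prodMk hdW)).fderiv X
  have hinj : Function.Injective (fderiv ℝ Ψ q) := by
    refine (injective_iff_map_eq_zero _).2 fun X hX => ?_
    rw [hdΨ q hq, Prod.mk_eq_zero, Prod.mk_eq_zero] at hX
    exact hlm X hX.1 hX.2.1 hX.2.2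
  have hΨ : ContDiffOn ℝ ∞ Ψ O :=
    hh.prodMk ((l.contDiff.comp_contDiffOn hV).prodMk (m.contDiff.comp_contDiffOn hW))
  obtain ⟨ψ, ε, hε, hqψ, hψO, hψ, htarget, hsymm⟩ :=
    exists_openPartialHomeomorph_target_eq_ball (by simp [hdim]) hO hΨ hq hinj
  refine ⟨l, m, ψ, ε, hε, hqψ, hψO, fun z => by rw [hψ], fun z hz => hψ ▸ hdΨ z (hψO hz), ?_,
    hψ ▸ hΨ.mono hψO, hsymm⟩
  rw [htarget, ball_prod_same, ball_prod_same]

theorem exists_separating_chart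
    (hdim : Module.finrank ℝ F = 3) {O : Set F} (hO : IsOpen O) {q : F} (hq : q ∈ O) {h : F → ℝ}
    {V : F → G} {W : F → H} (hh : ContDiffOn ℝ ∞ h O) (hV : ContDiffOn ℝ ∞ V O)
    (hW : ContDiffOn ℝ ∞ W O)
    (h₁ : ∀ z ∈ O, ∃ e, fderiv ℝ h z e ≠ 0 ∧ fderiv ℝ V z e = 0 ∧ fderiv ℝ W z e = 0)
    (h₂ : ∀ z ∈ O, h z = h q → ∃ e, fderiv ℝ h z e = 0 ∧ fderiv ℝ V z e ≠ 0 ∧ fderiv ℝ W z e = 0)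
    (h₃ : ∀ z ∈ O, h z = h q → ∃ e, fderiv ℝ h z e = 0 ∧ fderiv ℝ V z e = 0 ∧ fderiv ℝ W z e ≠ 0) :
    ∃ (l : G →L[ℝ] ℝ) (m : H →L[ℝ] ℝ) (ψ : OpenPartialHomeomorph F (ℝ × ℝ × ℝ)) (ε : ℝ), 0 < ε ∧
      q ∈ ψ.source ∧ ψ.source ⊆ O ∧ (∀ z, ψ z = (h z, l (V z), m (W z))) ∧
      ψ.target = Metric.ball (h q) ε ×ˢ Metric.ball (l (V q)) ε ×ˢ Metric.ball (m (W q)) ε ∧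
      (∀ p ∈ ψ.target, V (ψ.symm p) = V (ψ.symm (h q, p.2.1, m (W q)))) ∧
      ∀ p ∈ ψ.target, W (ψ.symm p) = W (ψ.symm (h q, l (V q), p.2.2)) := by
  obtain ⟨l, m, ψ, ε, hε, hqψ, hψO, hψ, hdψ, htarget, hsmooth, hsymm⟩ :=
    exists_openPartialHomeomorph_prod_prod hdim hO hq hh hV hW (h₁ q hq) (h₂ q hq rfl) (h₃ q hq rfl)
  have hconv : Convex ℝ ψ.target := htarget ▸ (convex_ball _ _).prod
    ((convex_ball _ _).prod (convex_ball _ _))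
  refine ⟨l, m, ψ, ε, hε, hqψ, hψO, hψ, htarget, fun ⟨s, v, w⟩ hp => ?_, fun ⟨s, v, w⟩ hp => ?_⟩ <;>
    obtain ⟨-, hv, hw⟩ := htarget ▸ hp
  · have hmove := comp_symm_eq_comp_symm_add (d := (0, 1)) (s₀ := h q) (r := m (W q) - w)
      hsmooth hsymm hconv (hV.mono hψO) (fun z hz => ?_) (fun z hz hzq => ?_) hp
      (by simpa [htarget, hε] using ⟨hv, hw⟩) (by simpa [htarget, hε] using hv)
    · simpa using hmove
    · obtain ⟨e, he, hVe, hWe⟩ := h₁ z (hψO hz)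
      exact ⟨e, fderiv ℝ h z e, ne_zero_of_map he, by simp [hdψ z hz, hVe, hWe], hVe⟩
    · obtain ⟨e, he, hVe, hWe⟩ := h₃ z (hψO hz) (by rwa [hψ] at hzq)
      exact ⟨e, m (fderiv ℝ W z e), ne_zero_of_map hWe, by simp [hdψ z hz, hVe, he], hVe⟩
  · have hmove := comp_symm_eq_comp_symm_add (d := (1, 0)) (s₀ := h q) (r := l (V q) - v)
      hsmooth hsymm hconv (hW.mono hψO) (fun z hz => ?_) (fun z hz hzq => ?_) hp
      (by simpa [htarget, hε] using ⟨hv, hw⟩) (by simpa [htarget, hε] using hw)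
    · simpa using hmove
    · obtain ⟨e, he, hVe, hWe⟩ := h₁ z (hψO hz)
      exact ⟨e, fderiv ℝ h z e, ne_zero_of_map he, by simp [hdψ z hz, hVe, hWe], hWe⟩
    · obtain ⟨e, he, hVe, hWe⟩ := h₂ z (hψO hz) (by rwa [hψ] at hzq)
      exact ⟨e, l (fderiv ℝ V z e), ne_zero_of_map hVe, by simp [hdψ z hz, hWe, he], hWe⟩

theorem exists_open_independent_values
    (hdim : Module.finrank ℝ F = 3) {O : Set F} (hO : IsOpen O) {q : F} (hq : q ∈ O) {h : F → ℝ}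
    {V : F → G} {W : F → H} (hh : ContDiffOn ℝ ∞ h O) (hV : ContDiffOn ℝ ∞ V O)
    (hW : ContDiffOn ℝ ∞ W O)
    (h₁ : ∀ z ∈ O, ∃ e, fderiv ℝ h z e ≠ 0 ∧ fderiv ℝ V z e = 0 ∧ fderiv ℝ W z e = 0)
    (h₂ : ∀ z ∈ O, h z = h q → ∃ e, fderiv ℝ h z e = 0 ∧ fderiv ℝ V z e ≠ 0 ∧ fderiv ℝ W z e = 0)
    (h₃ : ∀ z ∈ O, h z = h q → ∃ e, fderiv ℝ h z e = 0 ∧ fderiv ℝ V z e = 0 ∧ fderiv ℝ W z e ≠ 0) :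
    ∃ O' ⊆ O, IsOpen O' ∧ q ∈ O' ∧ (V '' O').Infinite ∧ (W '' O').Infinite ∧
      ∀ a ∈ O', ∀ b ∈ O', ∃ c ∈ O', V c = V a ∧ W c = W b := by
  obtain ⟨l, m, ψ, ε, hε, hqψ, hψO, hψ, htarget, hVeq, hWeq⟩ :=
    exists_separating_chart hdim hO hq hh hV hW h₁ h₂ h₃
  have hball : ∀ t : ℝ, (Metric.ball t ε).Infinite := fun t =>
    Real.ball_eq_Ioo t ε ▸ Set.Ioo_infinite (by linarith)
  refine ⟨ψ.source, hψO, ψ.open_source, hqψ, ?_, ?_, fun a ha b hb => ?_⟩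
  · refine Set.Infinite.of_image l ((hball (l (V q))).mono fun v hv => ?_)
    have hp : (h q, v, m (W q)) ∈ ψ.target := by simpa [htarget, hε] using hv
    exact ⟨_, ⟨_, ψ.map_target hp, rfl⟩, by simpa [hψ] using congrArg (·.2.1) (ψ.right_inv hp)⟩
  · refine Set.Infinite.of_image m ((hball (m (W q))).mono fun w hw => ?_)
    have hp : (h q, l (V q), w) ∈ ψ.target := by simpa [htarget, hε] using hw
    exact ⟨_, ⟨_, ψ.map_target hp, rfl⟩, by simpa [hψ] using congrArg (·.2.2) (ψ.right_inv hp)⟩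
  · have hat := ψ.map_source ha
    have hbt := ψ.map_source hb
    have hp : (h q, (ψ a).2.1, (ψ b).2.2) ∈ ψ.target := by
      rw [htarget] at hat hbt ⊢
      exact ⟨Metric.mem_ball_self hε, hat.2.1, hbt.2.2⟩
    refine ⟨_, ψ.map_target hp, ?_, ?_⟩
    · rw [hVeq _ hp, ← hVeq _ hat, ψ.left_inv ha]
    · rw [hWeq _ hp, ← hWeq _ hbt, ψ.left_inv hb]

end Analysis

section Curves

variable {F G : Type*} [NormedAddCommGroup F] [NormedSpace ℝ F]

theorem exists_primitive [NormedAddCommGroup G] [NormedSpace ℝ G] [CompleteSpace G] {f : ℝ → G}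
    {a ε : ℝ} (hf : ContDiffOn ℝ ∞ f (Metric.ball a ε)) :
    ∃ g : ℝ → G, g a = 0 ∧ ContDiffOn ℝ ∞ g (Metric.ball a ε) ∧
      ∀ t ∈ Metric.ball a ε, HasDerivAt g (f t) t := by
  have hderiv : ∀ t ∈ Metric.ball a ε, HasDerivAt (fun t => ∫ y in a..t, f y) (f t) t := by
    intro t ht
    have ha : a ∈ Metric.ball a ε := Metric.mem_ball_self (dist_nonneg.trans_lt ht)
    have hsub : Set.uIcc a t ⊆ Metric.ball a ε :=
      (convex_ball a ε).ordConnected.uIcc_subset ha ht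
    exact intervalIntegral.integral_hasDerivAt_right
      (hf.continuousOn.mono hsub).intervalIntegrable
      (hf.continuousOn.stronglyMeasurableAtFilter Metric.isOpen_ball t ht)
      (hf.continuousOn.continuousAt (Metric.isOpen_ball.mem_nhds ht))
  refine ⟨_, intervalIntegral.integral_same, ?_, hderiv⟩
  rw [contDiffOn_infty_iff_deriv_of_isOpen Metric.isOpen_ball]
  exact ⟨fun t ht => (hderiv t ht).differentiableAt.differentiableWithinAt,
    hf.congr fun t ht => (hderiv t ht).deriv⟩

theorem eq_inner_smul_add_of_mem_span_pair [NormedAddCommGroup G] [InnerProductSpace ℝ G]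
    {u w v : G} (hu : ‖u‖ = 1) (hw : ‖w‖ = 1) (huw : inner ℝ u w = 0)
    (hv : v ∈ Submodule.span ℝ {u, w}) : v = inner ℝ u v • u + inner ℝ w v • w := by
  obtain ⟨a, b, rfl⟩ := Submodule.mem_span_pair.1 hv
  have hwu : inner ℝ w u = 0 := by rw [real_inner_comm, huw]
  simp [inner_add_right, inner_smul_right, hu, hw, huw, hwu]

theorem inner_sq_add_inner_sq_of_mem_span_pair [NormedAddCommGroup G] [InnerProductSpace ℝ G]
    {u w v : G} (hu : ‖u‖ = 1) (hw : ‖w‖ = 1) (huw : inner ℝ u w = 0)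
    (hv : v ∈ Submodule.span ℝ {u, w}) : inner ℝ u v ^ 2 + inner ℝ w v ^ 2 = ‖v‖ ^ 2 := by
  rw [← real_inner_self_eq_norm_sq]
  nth_rw 3 [eq_inner_smul_add_of_mem_span_pair hu hw huw hv]
  rw [inner_add_left, real_inner_smul_left, real_inner_smul_left]
  ring

theorem exists_smooth_angle [NormedAddCommGroup G] [InnerProductSpace ℝ G] {O : Set F}
    (hO : IsOpen O) {q : F} (hq : q ∈ O) {V : F → G} (hV : ContDiffOn ℝ ∞ V O) {u w : G}
    (hu : ‖u‖ = 1) (hw : ‖w‖ = 1) (huw : inner ℝ u w = 0)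
    (hnorm : ∀ z ∈ O, ‖V z‖ = 1) (hspan : ∀ z ∈ O, V z ∈ Submodule.span ℝ {u, w})
    (hVq : V q = u) :
    ∃ O' ⊆ O, IsOpen O' ∧ q ∈ O' ∧ ∃ v : F → ℝ, ContDiffOn ℝ ∞ v O' ∧
      ∀ z ∈ O', V z = Real.cos (v z) • u + Real.sin (v z) • w := by
  have huV : ContDiffOn ℝ ∞ (fun z => inner ℝ u (V z)) O := contDiffOn_const.inner ℝ hV
  have hwV : ContDiffOn ℝ ∞ (fun z => inner ℝ w (V z)) O := contDiffOn_const.inner ℝ hV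
  have hsq : ∀ z ∈ O, inner ℝ u (V z) ^ 2 + inner ℝ w (V z) ^ 2 = 1 := fun z hz => by
    rw [inner_sq_add_inner_sq_of_mem_span_pair hu hw huw (hspan z hz), hnorm z hz, one_pow]
  refine ⟨O ∩ (fun z => inner ℝ u (V z)) ⁻¹' Set.Ioi 0, Set.inter_subset_left,
    huV.continuousOn.isOpen_inter_preimage hO isOpen_Ioi, ⟨hq, by simp [hVq, hu]⟩,
    fun z => Real.arcsin (inner ℝ w (V z)), ?_, ?_⟩
  · rintro z ⟨hz, hpos : 0 < inner ℝ u (V z)⟩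
    have hlt : inner ℝ w (V z) ^ 2 < 1 := by nlinarith [hsq z hz]
    have harcsin := Real.contDiffAt_arcsin (n := ∞) (x := inner ℝ w (V z))
      (fun h => by simp [h] at hlt) (fun h => by simp [h] at hlt)
    exact (harcsin.comp z (hwV.contDiffAt (hO.mem_nhds hz))).contDiffWithinAt
  · rintro z ⟨hz, hpos : 0 < inner ℝ u (V z)⟩
    have hcos : Real.cos (Real.arcsin (inner ℝ w (V z))) = inner ℝ u (V z) := by
      rw [Real.cos_arcsin, ← hsq z hz, add_sub_cancel_right, Real.sqrt_sq hpos.le]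
    have hsin : Real.sin (Real.arcsin (inner ℝ w (V z))) = inner ℝ w (V z) :=
      Real.sin_arcsin (by nlinarith [hsq z hz]) (by nlinarith [hsq z hz])
    rw [hcos, hsin]
    exact eq_inner_smul_add_of_mem_span_pair hu hw huw (hspan z hz)

theorem exists_arclength_parameter {t₀ ε : ℝ} (hε : 0 < ε) {γ : ℝ → ℝ}
    (hγ : ContDiffOn ℝ ∞ γ (Metric.ball t₀ ε)) :
    ∃ ψ : OpenPartialHomeomorph ℝ ℝ, t₀ ∈ ψ.source ∧ ψ.source ⊆ Metric.ball t₀ ε ∧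
      ContDiffOn ℝ ∞ ψ ψ.source ∧ ContDiffOn ℝ ∞ ψ.symm ψ.target ∧ ψ.target.OrdConnected ∧
      ∀ t ∈ ψ.source, HasDerivAt ψ (Real.sqrt (1 + deriv γ t ^ 2)) t := by
  have hpos : ∀ t, 0 < 1 + deriv γ t ^ 2 := fun t => by positivity
  have hγ' : ContDiffOn ℝ ∞ (deriv γ) (Metric.ball t₀ ε) :=
    ((contDiffOn_infty_iff_deriv_of_isOpen Metric.isOpen_ball).1 hγ).2
  obtain ⟨g, -, hg, hg'⟩ := exists_primitive
    ((contDiffOn_const.add (hγ'.pow 2)).sqrt fun t _ => (hpos t).ne' :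
      ContDiffOn ℝ ∞ (fun t => Real.sqrt (1 + deriv γ t ^ 2)) (Metric.ball t₀ ε))
  have hinj : Function.Injective (fderiv ℝ g t₀) := by
    rw [injective_iff_map_eq_zero]
    intro X hX
    rw [fderiv_eq_smul_deriv, (hg' t₀ (Metric.mem_ball_self hε)).deriv] at hX
    exact (smul_eq_zero.1 hX).resolve_right (Real.sqrt_pos.2 (hpos t₀)).ne'
  obtain ⟨ψ, δ, -, ht₀, hsub, hψ, htarget, hsymm⟩ := exists_openPartialHomeomorph_target_eq_ball
    rfl Metric.isOpen_ball hg (Metric.mem_ball_self hε) hinj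
  subst hψ
  exact ⟨ψ, ht₀, hsub, hg.mono hsub, hsymm, htarget ▸ (convex_ball _ _).ordConnected,
    fun t ht => hg' t (hsub ht)⟩

theorem exists_profile {J : Set ℝ} (hJ : IsOpen J) {t₀ : ℝ} (ht₀ : t₀ ∈ J) {γ : ℝ → ℝ}
    (hγ : ContDiffOn ℝ ∞ γ J) (hγ₀ : γ t₀ ∈ Set.Ioo 0 (Real.pi / 2)) :
    ∃ ψ : OpenPartialHomeomorph ℝ ℝ, t₀ ∈ ψ.source ∧
      ContDiffOn ℝ ∞ ψ ψ.source ∧ (∀ t ∈ ψ.source, deriv ψ t ≠ 0) ∧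
      IsProfile ψ.target (γ ∘ ψ.symm) ψ.symm := by
  obtain ⟨ε, hε, hball⟩ := Metric.isOpen_iff.1
    (hγ.continuousOn.isOpen_inter_preimage hJ isOpen_Ioo) t₀ ⟨ht₀, hγ₀⟩
  have hγball : ContDiffOn ℝ ∞ γ (Metric.ball t₀ ε) := hγ.mono fun t ht => (hball ht).1
  obtain ⟨ψ, ht₀ψ, hsub, hψ, hsymm, hconn, hψ'⟩ := exists_arclength_parameter hε hγball
  have hpos : ∀ t, 0 < 1 + deriv γ t ^ 2 := fun t => by positivity
  have hsqrt : ∀ t, Real.sqrt (1 + deriv γ t ^ 2) ≠ 0 := fun t => (Real.sqrt_pos.2 (hpos t)).ne'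
  have hmem : ∀ s ∈ ψ.target, ψ.symm s ∈ Metric.ball t₀ ε := fun s hs => hsub (ψ.map_target hs)
  have hangle : ∀ s ∈ ψ.target, (γ ∘ ψ.symm) s ∈ Set.Ioo 0 (Real.pi / 2) :=
    fun s hs => (hball (hmem s hs)).2
  refine ⟨ψ, ht₀ψ, hψ,
    fun t ht => (hψ' t ht).deriv.symm ▸ hsqrt t, ψ.open_target, hconn,
    hγball.comp hsymm hmem, hsymm, fun s hs => ?_,
    fun s hs => Real.cos_pos_of_mem_Ioo
      ⟨by linarith [(hangle s hs).1, Real.pi_pos], (hangle s hs).2⟩,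
    fun s hs => Real.sin_pos_of_pos_of_lt_pi (hangle s hs).1
      (by linarith [(hangle s hs).2, Real.pi_pos])⟩
  have hderiv : HasDerivAt ψ.symm (Real.sqrt (1 + deriv γ (ψ.symm s) ^ 2))⁻¹ s :=
    ψ.hasDerivAt_symm hs (hsqrt _) (hψ' _ (ψ.map_target hs))
  have hγs : HasDerivAt γ (deriv γ (ψ.symm s)) (ψ.symm s) :=
    ((hγball.contDiffAt (Metric.isOpen_ball.mem_nhds (hmem s hs))).differentiableAt
      (by simp)).hasDerivAt
  rw [(hγs.comp s hderiv).deriv, hderiv.deriv, mul_pow, inv_pow, Real.sq_sqrt (hpos _).le]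
  field_simp [(hpos (ψ.symm s)).ne']
  ring

end Curves

section Planes

variable {G : Type*} [NormedAddCommGroup G] [InnerProductSpace ℝ G]

theorem two_le_finrank_vectorSpan [FiniteDimensional ℝ G] {A : Set G} {R : ℝ}
    (hA : ∀ a ∈ A, ‖a‖ = R) (hinf : A.Infinite) :
    2 ≤ Module.finrank ℝ (vectorSpan ℝ A) := by
  obtain ⟨s, hsA, hs⟩ := hinf.exists_subset_ncard_eq 3
  obtain ⟨a, b, c, hab, hac, hbc, rfl⟩ := Set.ncard_eq_three.1 hs.2
  have hcospherical : EuclideanGeometry.Cospherical ({a, b, c} : Set G) :=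
    ⟨0, R, fun y hy => by rw [dist_zero_right, hA y (hsA hy)]⟩
  have hrank := (hcospherical.affineIndependent_of_ne hab hac hbc).finrank_vectorSpan
    (n := 2) (by simp)
  rw [Matrix.range_cons, Matrix.range_cons, Matrix.range_cons, Matrix.range_empty,
    Set.union_empty, Set.singleton_union, Set.singleton_union] at hrank
  exact hrank.ge.trans (Submodule.finrank_mono (vectorSpan_mono ℝ hsA))

theorem inner_eq_zero_of_mem_vectorSpan {A : Set G} {y v : G} {c : ℝ}
    (hc : ∀ a ∈ A, inner ℝ a y = c) (hv : v ∈ vectorSpan ℝ A) : inner ℝ v y = 0 := by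
  refine Submodule.span_induction ?_ (inner_zero_left y) ?_ ?_ hv
  · rintro _ ⟨a, ha, b, hb, rfl⟩
    change inner ℝ (a - b) y = 0
    rw [inner_sub_left, hc a ha, hc b hb, sub_self]
  · intro u w _ _ hu hw
    rw [inner_add_left, hu, hw, add_zero]
  · intro r u _ hu
    rw [real_inner_smul_left, hu, mul_zero]

theorem vectorSpan_le_span (A : Set G) : vectorSpan ℝ A ≤ Submodule.span ℝ A := by
  refine Submodule.span_le.2 ?_
  rintro _ ⟨a, ha, b, hb, rfl⟩
  exact sub_mem (Submodule.subset_span ha) (Submodule.subset_span hb)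

theorem finrank_span_eq_two_and_vectorSpan_eq_span (hdim : Module.finrank ℝ G = 5) {A B : Set G}
    {e : G} {R R' c : ℝ} (he : e ≠ 0) (hA : ∀ a ∈ A, ‖a‖ = R) (hB : ∀ b ∈ B, ‖b‖ = R')
    (hAe : ∀ a ∈ A, inner ℝ a e = 0) (hBe : ∀ b ∈ B, inner ℝ b e = 0)
    (hAB : ∀ a ∈ A, ∀ b ∈ B, inner ℝ a b = c) (hAinf : A.Infinite) (hBinf : B.Infinite) :
    Module.finrank ℝ (Submodule.span ℝ A) = 2 ∧ vectorSpan ℝ A = Submodule.span ℝ A := by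
  have : FiniteDimensional ℝ G := Module.finite_of_finrank_pos (by omega)
  have hortho : vectorSpan ℝ B ⟂ ℝ ∙ e := by
    rw [Submodule.isOrtho_iff_inner_eq]
    intro v hv w hw
    obtain ⟨r, rfl⟩ := Submodule.mem_span_singleton.1 hw
    rw [real_inner_smul_right, inner_eq_zero_of_mem_vectorSpan hBe hv, mul_zero]
  have hspanA : Submodule.span ℝ A ≤ (vectorSpan ℝ B ⊔ ℝ ∙ e)ᗮ := by
    refine Submodule.span_le.2 fun a ha => ?_
    rw [← Submodule.inf_orthogonal]
    refine ⟨fun v hv => inner_eq_zero_of_mem_vectorSpan (c := c) (fun b hb => ?_) hv, ?_⟩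
    · rw [real_inner_comm, hAB a ha b hb]
    · exact Submodule.mem_orthogonal_singleton_iff_inner_left.2 (hAe a ha)
  have hsup : Module.finrank ℝ (vectorSpan ℝ B ⊔ ℝ ∙ e : Submodule ℝ G) =
      Module.finrank ℝ (vectorSpan ℝ B) + 1 := by
    rw [← finrank_span_singleton he (K := ℝ), ← Submodule.finrank_sup_add_finrank_inf_eq,
      hortho.disjoint.eq_bot, finrank_bot, add_zero]
  have h₁ := Submodule.finrank_mono hspanA
  have h₂ := Submodule.finrank_add_finrank_orthogonal (vectorSpan ℝ B ⊔ ℝ ∙ e)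
  have h₃ := two_le_finrank_vectorSpan hA hAinf
  have h₄ := two_le_finrank_vectorSpan hB hBinf
  have h₅ := Submodule.finrank_mono (vectorSpan_le_span A)
  exact ⟨by omega, Submodule.eq_of_le_of_finrank_le (vectorSpan_le_span A) (by omega)⟩

theorem exists_unit_vector_span_pair_eq {S : Submodule ℝ G} (hS : Module.finrank ℝ S = 2) {a : G}
    (ha : a ∈ S) (hnorm : ‖a‖ = 1) :
    ∃ a', ‖a'‖ = 1 ∧ inner ℝ a a' = 0 ∧ Submodule.span ℝ {a, a'} = S := by
  have : FiniteDimensional ℝ S := Module.finite_of_finrank_pos (by omega)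
  have horth : Orthonormal ℝ (Set.domRestrict {0} fun _ : Fin 2 => (⟨a, ha⟩ : S)) :=
    ⟨fun _ => hnorm, fun i j hij => absurd (Subsingleton.elim i j) hij⟩
  obtain ⟨b, hb⟩ := horth.exists_orthonormalBasis_extension_of_card_eq (by simpa using hS)
  have hb₀ : (b 0 : G) = a := by rw [hb 0 rfl]
  refine ⟨b 1, b.norm_eq_one 1, ?_, ?_⟩
  · rw [← hb₀]
    exact b.orthonormal.2 (by decide)
  · have hspan := congrArg (Submodule.map S.subtype) b.toBasis.span_eq
    rw [Submodule.map_span, Submodule.map_top, Submodule.range_subtype] at hspan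
    have hrange : Set.range b.toBasis = {b 0, b 1} := by
      ext v
      simp [Fin.exists_fin_two, eq_comm]
    rwa [hrange, Set.image_pair, Submodule.subtype_apply, Submodule.subtype_apply, hb₀] at hspan

theorem orthonormal_of_pairs {a a' b b' e : G} (ha : ‖a‖ = 1) (ha' : ‖a'‖ = 1) (hb : ‖b‖ = 1)
    (hb' : ‖b'‖ = 1) (he : ‖e‖ = 1) (haa' : inner ℝ a a' = 0) (hbb' : inner ℝ b b' = 0)
    (hS : Submodule.span ℝ {a, a'} ⟂ Submodule.span ℝ {b, b'})
    (hSe : Submodule.span ℝ {a, a'} ⟂ ℝ ∙ e) (hTe : Submodule.span ℝ {b, b'} ⟂ ℝ ∙ e) :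
    Orthonormal ℝ ![a, a', b, b', e] := by
  simp only [Submodule.isOrtho_span, Set.mem_insert_iff, Set.mem_singleton_iff, forall_eq_or_imp,
    forall_eq] at hS hSe hTe
  rw [orthonormal_iff_ite]
  intro i j
  fin_cases i <;> fin_cases j <;>
    simp [*, real_inner_comm]

theorem exists_orthonormalBasis_of_inner_eq_const (hdim : Module.finrank ℝ G = 5) {A B : Set G}
    {e : G} {c : ℝ} (he : ‖e‖ = 1) (hA : ∀ a ∈ A, ‖a‖ = 1) (hB : ∀ b ∈ B, ‖b‖ = 1)
    (hAe : ∀ a ∈ A, inner ℝ a e = 0) (hBe : ∀ b ∈ B, inner ℝ b e = 0)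
    (hAB : ∀ a ∈ A, ∀ b ∈ B, inner ℝ a b = c) (hAinf : A.Infinite) (hBinf : B.Infinite)
    {a₀ b₀ : G} (ha₀ : a₀ ∈ A) (hb₀ : b₀ ∈ B) :
    c = 0 ∧ ∃ b : OrthonormalBasis (Fin 5) ℝ G, b 0 = a₀ ∧ b 2 = b₀ ∧ b 4 = e ∧
      A ⊆ Submodule.span ℝ {b 0, b 1} ∧ B ⊆ Submodule.span ℝ {b 2, b 3} := by
  have : FiniteDimensional ℝ G := Module.finite_of_finrank_pos (by omega)
  have hBA : ∀ b ∈ B, ∀ a ∈ A, inner ℝ b a = c :=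
    fun b hb a ha => by rw [real_inner_comm, hAB a ha b hb]
  have he₀ : e ≠ 0 := norm_ne_zero_iff.1 (by simp [he])
  obtain ⟨hA₂, hspanA⟩ := finrank_span_eq_two_and_vectorSpan_eq_span hdim he₀ hA hB hAe hBe hAB
    hAinf hBinf
  obtain ⟨hB₂, -⟩ := finrank_span_eq_two_and_vectorSpan_eq_span hdim he₀ hB hA hBe hAe hBA
    hBinf hAinf
  have hAB₀ : ∀ a ∈ A, ∀ b ∈ B, inner ℝ a b = 0 := fun a ha b hb =>
    inner_eq_zero_of_mem_vectorSpan (fun a ha => hAB a ha b hb)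
      (hspanA ▸ Submodule.subset_span ha)
  obtain ⟨a₁, ha₁, ha₀₁, hspan_a⟩ :=
    exists_unit_vector_span_pair_eq hA₂ (Submodule.subset_span ha₀) (hA a₀ ha₀)
  obtain ⟨b₁, hb₁, hb₀₁, hspan_b⟩ :=
    exists_unit_vector_span_pair_eq hB₂ (Submodule.subset_span hb₀) (hB b₀ hb₀)
  have horth : Orthonormal ℝ ![a₀, a₁, b₀, b₁, e] := by
    apply orthonormal_of_pairs (hA a₀ ha₀) ha₁ (hB b₀ hb₀) hb₁ he ha₀₁ hb₀₁
    · rwa [hspan_a, hspan_b, Submodule.isOrtho_span]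
    · rw [hspan_a, Submodule.isOrtho_span]
      simpa using hAe
    · rw [hspan_b, Submodule.isOrtho_span]
      simpa using hBe
  refine ⟨by rw [← hAB a₀ ha₀ b₀ hb₀, hAB₀ a₀ ha₀ b₀ hb₀], OrthonormalBasis.mk horth
    (horth.linearIndependent.span_eq_top_of_card_eq_finrank' (by simp [hdim])).ge, ?_⟩
  rw [OrthonormalBasis.coe_mk]
  exact ⟨rfl, rfl, rfl, fun a ha => hspan_a ▸ Submodule.subset_span ha,
    fun b hb => hspan_b ▸ Submodule.subset_span hb⟩

theorem eq_inner_smul_add_of_mem_orthogonal {K : Submodule ℝ G} {n ξ v : G}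
    (hK : Module.finrank ℝ K + 2 = Module.finrank ℝ G) (hn : ‖n‖ = 1) (hξ : ‖ξ‖ = 1)
    (hnξ : inner ℝ n ξ = 0) (hnK : n ∈ Kᗮ) (hξK : ξ ∈ Kᗮ) (hv : v ∈ Kᗮ) :
    v = inner ℝ n v • n + inner ℝ ξ v • ξ := by
  have : FiniteDimensional ℝ G := Module.finite_of_finrank_pos (by omega)
  have hKperp : Module.finrank ℝ Kᗮ = 2 := by
    have hsum := K.finrank_add_finrank_orthogonal
    omega
  have hpair : LinearIndependent ℝ ![n, ξ] := by
    refine Orthonormal.linearIndependent (𝕜 := ℝ) ?_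
    rw [orthonormal_iff_ite]
    intro i j
    fin_cases i <;> fin_cases j <;> simp [*, real_inner_comm]
  have hspan : Submodule.span ℝ {n, ξ} = Kᗮ := by
    refine Submodule.eq_of_le_of_finrank_eq (Submodule.span_le.2 (Set.pair_subset hnK hξK)) ?_
    rw [hKperp, ← Matrix.range_cons_cons_empty n ξ ![], finrank_span_eq_card hpair,
      Fintype.card_fin]
  exact eq_inner_smul_add_of_mem_span_pair hn hξ hnξ (hspan ▸ hv)

end Planes

section ParallelFamily

variable {α F G : Type*} [NormedAddCommGroup F] [NormedSpace ℝ F] [NormedAddCommGroup G]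
  [InnerProductSpace ℝ G]

/-- The level sets of `h` in `O` are mapped by `P` to a family of parallel hypersurfaces of the unit
sphere of the orthogonal complement of `e`, with unit normal `ν`: the surface at height `t` has
signed distance `β t` from the one at height `t₀`, and the latter has principal curvatures
`κ₂, κ₃`. -/
structure IsParallelFamily (e : G) (J : Set ℝ) (O : Set F) (P ν : F → G) (h : F → ℝ) (β : ℝ → ℝ)
    (t₀ κ₂ κ₃ : ℝ) : Prop where
  isOpen_heights : IsOpen J
  isOpen_domain : IsOpen O
  mapsTo_height : Set.MapsTo h O J
  smooth_height : ContDiffOn ℝ ∞ h O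
  smooth_position : ContDiffOn ℝ ∞ P O
  smooth_normal : ContDiffOn ℝ ∞ ν O
  smooth_distance : ContDiffOn ℝ ∞ β J
  distance_eq_zero : β t₀ = 0
  norm_position : ∀ z ∈ O, ‖P z‖ = 1
  norm_normal : ∀ z ∈ O, ‖ν z‖ = 1
  inner_position_normal : ∀ z ∈ O, inner ℝ (P z) (ν z) = 0
  inner_position_axis : ∀ z ∈ O, inner ℝ (P z) e = 0
  inner_normal_axis : ∀ z ∈ O, inner ℝ (ν z) e = 0
  transverse : ∀ z ∈ O, ∃ X, fderiv ℝ h z X ≠ 0 ∧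
    fderiv ℝ P z X = -(deriv β (h z) * fderiv ℝ h z X) • ν z ∧
    fderiv ℝ ν z X = (deriv β (h z) * fderiv ℝ h z X) • P z
  principal₂ : ∀ z ∈ O, h z = t₀ → ∃ X, fderiv ℝ h z X = 0 ∧ fderiv ℝ P z X ≠ 0 ∧
    fderiv ℝ ν z X = -κ₂ • fderiv ℝ P z X
  principal₃ : ∀ z ∈ O, h z = t₀ → ∃ X, fderiv ℝ h z X = 0 ∧ fderiv ℝ P z X ≠ 0 ∧
    fderiv ℝ ν z X = -κ₃ • fderiv ℝ P z X

/-- The point of the normal great circle `φ ↦ cos φ P + sin φ ν` of the surface at height `h z` that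
lies at signed distance `φ` from the reference surface, where `β = 0`. -/
noncomputable def parallelMap (P ν : α → G) (h : α → ℝ) (β : ℝ → ℝ) (φ : ℝ) (z : α) : G :=
  Real.cos (φ + β (h z)) • P z + Real.sin (φ + β (h z)) • ν z

theorem cos_smul_parallelMap_add_sin_smul_parallelMap (P ν : α → G) (h : α → ℝ) (β : ℝ → ℝ) (φ : ℝ)
    (z : α) : Real.cos (φ + β (h z)) • parallelMap P ν h β φ z +
      Real.sin (φ + β (h z)) • parallelMap P ν h β (φ - Real.pi / 2) z = P z := by
  have hshift : φ - Real.pi / 2 + β (h z) = φ + β (h z) - Real.pi / 2 := by ring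
  rw [parallelMap, parallelMap, hshift, Real.cos_sub_pi_div_two, Real.sin_sub_pi_div_two]
  match_scalars
  · linear_combination Real.sin_sq_add_cos_sq (φ + β (h z))
  · ring

theorem exists_focal_angles {κ₂ κ₃ : ℝ} (hlt : κ₃ < κ₂) :
    ∃ φ₂ φ₃ : ℝ, Real.cos φ₂ - κ₂ * Real.sin φ₂ = 0 ∧ Real.cos φ₃ - κ₃ * Real.sin φ₃ = 0 ∧
      0 < φ₂ ∧ φ₃ < 0 ∧ 0 < φ₂ - φ₃ ∧ φ₂ - φ₃ < Real.pi := by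
  have hκ : ∀ κ : ℝ, Real.sin (Real.arctan κ) = κ * Real.cos (Real.arctan κ) := fun κ => by
    rw [← Real.tan_mul_cos (Real.cos_arctan_pos κ).ne', Real.tan_arctan]
  have hmono := Real.arctan_strictMono hlt
  have h₂ := Real.arctan_mem_Ioo κ₂
  have h₃ := Real.arctan_mem_Ioo κ₃
  refine ⟨Real.pi / 2 - Real.arctan κ₂, -(Real.arctan κ₃ + Real.pi / 2), ?_, ?_, ?_, ?_, ?_, ?_⟩
  · rw [Real.cos_pi_div_two_sub, Real.sin_pi_div_two_sub, hκ, sub_self]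
  · rw [Real.cos_neg, Real.sin_neg, Real.cos_add_pi_div_two, Real.sin_add_pi_div_two, hκ]
    ring
  all_goals linarith [h₂.1, h₂.2, h₃.1, h₃.2]

theorem cos_sub_mul_sin_ne_zero {κ κ' φ : ℝ} (hφ : Real.cos φ - κ * Real.sin φ = 0) (hκ : κ ≠ κ') :
    Real.cos φ - κ' * Real.sin φ ≠ 0 := by
  intro hφ'
  have hsin : Real.sin φ = 0 := by
    refine (mul_eq_zero.1 (?_ : (κ - κ') * Real.sin φ = 0)).resolve_left (sub_ne_zero.2 hκ)
    linear_combination hφ' - hφ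
  have hcos : Real.cos φ = 0 := by simpa [hsin] using hφ
  simpa [hsin, hcos] using Real.sin_sq_add_cos_sq φ

namespace IsParallelFamily

variable {e : G} {J : Set ℝ} {O : Set F} {P ν : F → G} {h : F → ℝ} {β : ℝ → ℝ} {t₀ κ₂ κ₃ : ℝ}

theorem swap (hp : IsParallelFamily e J O P ν h β t₀ κ₂ κ₃) :
    IsParallelFamily e J O P ν h β t₀ κ₃ κ₂ :=
  { hp with principal₂ := hp.principal₃, principal₃ := hp.principal₂ }

theorem contDiffOn_parallelMap (hp : IsParallelFamily e J O P ν h β t₀ κ₂ κ₃) (φ : ℝ) :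
    ContDiffOn ℝ ∞ (parallelMap P ν h β φ) O := by
  have hangle : ContDiffOn ℝ ∞ (fun z => φ + β (h z)) O :=
    contDiffOn_const.add (hp.smooth_distance.comp hp.smooth_height hp.mapsTo_height)
  exact (hangle.cos.smul hp.smooth_position).add (hangle.sin.smul hp.smooth_normal)

theorem inner_parallelMap (hp : IsParallelFamily e J O P ν h β t₀ κ₂ κ₃) (φ ψ : ℝ) {z : F}
    (hz : z ∈ O) :
    inner ℝ (parallelMap P ν h β φ z) (parallelMap P ν h β ψ z) = Real.cos (φ - ψ) := by
  have hνP : inner ℝ (ν z) (P z) = 0 := by rw [real_inner_comm, hp.inner_position_normal z hz]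
  have hsub : φ - ψ = (φ + β (h z)) - (ψ + β (h z)) := by ring
  rw [hsub, Real.cos_sub]
  simp only [parallelMap, inner_add_left, inner_add_right, real_inner_smul_left,
    real_inner_smul_right, real_inner_self_eq_norm_sq, hp.norm_position z hz, hp.norm_normal z hz,
    hp.inner_position_normal z hz, hνP]
  ring

theorem norm_parallelMap (hp : IsParallelFamily e J O P ν h β t₀ κ₂ κ₃) (φ : ℝ) {z : F}
    (hz : z ∈ O) : ‖parallelMap P ν h β φ z‖ = 1 := by
  have hself := hp.inner_parallelMap φ φ hz
  rw [sub_self, Real.cos_zero, real_inner_self_eq_norm_sq] at hself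
  exact (pow_eq_one_iff_of_nonneg (norm_nonneg _) two_ne_zero).1 hself

theorem inner_parallelMap_axis (hp : IsParallelFamily e J O P ν h β t₀ κ₂ κ₃) (φ : ℝ) {z : F}
    (hz : z ∈ O) : inner ℝ (parallelMap P ν h β φ z) e = 0 := by
  rw [parallelMap, inner_add_left, real_inner_smul_left, real_inner_smul_left,
    hp.inner_position_axis z hz, hp.inner_normal_axis z hz, mul_zero, mul_zero, add_zero]

theorem fderiv_parallelMap (hp : IsParallelFamily e J O P ν h β t₀ κ₂ κ₃) (φ : ℝ) {z : F}
    (hz : z ∈ O) (X : F) : fderiv ℝ (parallelMap P ν h β φ) z X =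
      Real.cos (φ + β (h z)) • (fderiv ℝ P z X + (deriv β (h z) * fderiv ℝ h z X) • ν z) +
      Real.sin (φ + β (h z)) • (fderiv ℝ ν z X - (deriv β (h z) * fderiv ℝ h z X) • P z) := by
  have hβ : HasDerivAt β (deriv β (h z)) (h z) :=
    ((hp.smooth_distance.contDiffAt (hp.isOpen_heights.mem_nhds
      (hp.mapsTo_height hz))).differentiableAt (by simp)).hasDerivAt
  have hangle : HasFDerivAt (fun z => φ + β (h z)) (deriv β (h z) • fderiv ℝ h z) z :=
    (hβ.comp_hasFDerivAt z
      (hasFDerivAt_of_contDiffOn hp.isOpen_domain hp.smooth_height hz)).const_add φ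
  have hpar := (hangle.cos.smul
    (hasFDerivAt_of_contDiffOn hp.isOpen_domain hp.smooth_position hz)).add
    (hangle.sin.smul (hasFDerivAt_of_contDiffOn hp.isOpen_domain hp.smooth_normal hz))
  rw [HasFDerivAt.fderiv (f := parallelMap P ν h β φ) hpar]
  simp only [add_apply, smul_apply, ContinuousLinearMap.smulRight_apply, smul_eq_mul]
  module

theorem exists_forall_fderiv_parallelMap_eq_zero (hp : IsParallelFamily e J O P ν h β t₀ κ₂ κ₃)
    {z : F} (hz : z ∈ O) :
    ∃ X, fderiv ℝ h z X ≠ 0 ∧ ∀ φ, fderiv ℝ (parallelMap P ν h β φ) z X = 0 := by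
  obtain ⟨X, hhX, hPX, hνX⟩ := hp.transverse z hz
  refine ⟨X, hhX, fun φ => ?_⟩
  rw [hp.fderiv_parallelMap φ hz, hPX, hνX, neg_smul, neg_add_cancel, sub_self, smul_zero,
    smul_zero, add_zero]

theorem fderiv_parallelMap_of_principal (hp : IsParallelFamily e J O P ν h β t₀ κ₂ κ₃) (φ : ℝ)
    {z X : F} {κ : ℝ} (hz : z ∈ O) (hht : h z = t₀) (hhX : fderiv ℝ h z X = 0)
    (hνX : fderiv ℝ ν z X = -κ • fderiv ℝ P z X) :
    fderiv ℝ (parallelMap P ν h β φ) z X =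
      (Real.cos φ - κ * Real.sin φ) • fderiv ℝ P z X := by
  rw [hp.fderiv_parallelMap φ hz, hhX, hνX, hht, hp.distance_eq_zero, add_zero]
  module

theorem exists_fderiv_parallelMap_ne_zero (hp : IsParallelFamily e J O P ν h β t₀ κ₂ κ₃)
    {φ₂ φ₃ : ℝ} (hκ : κ₂ ≠ κ₃) (hφ₂ : Real.cos φ₂ - κ₂ * Real.sin φ₂ = 0)
    (hφ₃ : Real.cos φ₃ - κ₃ * Real.sin φ₃ = 0) {z : F} (hz : z ∈ O) (hht : h z = t₀) :
    ∃ X, fderiv ℝ h z X = 0 ∧ fderiv ℝ (parallelMap P ν h β φ₂) z X ≠ 0 ∧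
      fderiv ℝ (parallelMap P ν h β φ₃) z X = 0 := by
  obtain ⟨X, hhX, hPX, hνX⟩ := hp.principal₃ z hz hht
  refine ⟨X, hhX, ?_, ?_⟩
  · rw [hp.fderiv_parallelMap_of_principal φ₂ hz hht hhX hνX]
    exact smul_ne_zero (cos_sub_mul_sin_ne_zero hφ₂ hκ) hPX
  · rw [hp.fderiv_parallelMap_of_principal φ₃ hz hht hhX hνX, hφ₃, zero_smul]

/-- The focal maps are independent of each other and of `h`, but their inner product is constant:
this forces them into orthogonal planes. -/
theorem exists_orthogonal_planes
    (hp : IsParallelFamily e J O P ν h β t₀ κ₂ κ₃)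
    (hF : Module.finrank ℝ F = 3) (hG : Module.finrank ℝ G = 5) (he : ‖e‖ = 1) {q : F} (hq : q ∈ O)
    (hqt : h q = t₀) {φ₂ φ₃ : ℝ} (hκ : κ₂ ≠ κ₃) (hφ₂ : Real.cos φ₂ - κ₂ * Real.sin φ₂ = 0)
    (hφ₃ : Real.cos φ₃ - κ₃ * Real.sin φ₃ = 0) :
    Real.cos (φ₂ - φ₃) = 0 ∧ ∃ O' ⊆ O, IsOpen O' ∧ q ∈ O' ∧
      ∃ b : OrthonormalBasis (Fin 5) ℝ G, b 4 = e ∧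
        b 0 = parallelMap P ν h β φ₂ q ∧ b 2 = parallelMap P ν h β φ₃ q ∧
        (∀ z ∈ O', parallelMap P ν h β φ₂ z ∈ Submodule.span ℝ {b 0, b 1}) ∧
        (∀ z ∈ O', parallelMap P ν h β φ₃ z ∈ Submodule.span ℝ {b 2, b 3}) := by
  obtain ⟨O', hO'O, hO', hqO', hinf₂, hinf₃, hind⟩ := exists_open_independent_values hF
    hp.isOpen_domain hq hp.smooth_height (hp.contDiffOn_parallelMap φ₂)
    (hp.contDiffOn_parallelMap φ₃)
    (fun z hz => (hp.exists_forall_fderiv_parallelMap_eq_zero hz).imp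
      fun X hX => ⟨hX.1, hX.2 φ₂, hX.2 φ₃⟩)
    (fun z hz hzq => hp.exists_fderiv_parallelMap_ne_zero hκ hφ₂ hφ₃ hz (hzq.trans hqt))
    (fun z hz hzq => (hp.swap.exists_fderiv_parallelMap_ne_zero hκ.symm hφ₃ hφ₂ hz
      (hzq.trans hqt)).imp fun X hX => ⟨hX.1, hX.2.2, hX.2.1⟩)
  obtain ⟨hcos, b, hb₀, hb₂, hb₄, hA, hB⟩ := exists_orthonormalBasis_of_inner_eq_const hG
    (A := parallelMap P ν h β φ₂ '' O') (B := parallelMap P ν h β φ₃ '' O')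
    (c := Real.cos (φ₂ - φ₃)) he
    (Set.forall_mem_image.2 fun z hz => hp.norm_parallelMap φ₂ (hO'O hz))
    (Set.forall_mem_image.2 fun z hz => hp.norm_parallelMap φ₃ (hO'O hz))
    (Set.forall_mem_image.2 fun z hz => hp.inner_parallelMap_axis φ₂ (hO'O hz))
    (Set.forall_mem_image.2 fun z hz => hp.inner_parallelMap_axis φ₃ (hO'O hz))
    (Set.forall_mem_image.2 fun z hz => Set.forall_mem_image.2 fun y hy => by
      obtain ⟨c, hc, hc₂, hc₃⟩ := hind z hz y hy
      rw [← hc₂, ← hc₃, hp.inner_parallelMap φ₂ φ₃ (hO'O hc)])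
    hinf₂ hinf₃ (Set.mem_image_of_mem _ hqO') (Set.mem_image_of_mem _ hqO')
  exact ⟨hcos, O', hO'O, hO', hqO', b, hb₄, hb₀, hb₂, Set.image_subset_iff.1 hA,
    Set.image_subset_iff.1 hB⟩

theorem eq_zero_of_fderiv_parallelMap_eq_zero
    (hp : IsParallelFamily e J O P ν h β t₀ κ₂ κ₃)
    (hF : Module.finrank ℝ F = 3) {q X : F} (hq : q ∈ O) (hqt : h q = t₀) {φ₂ φ₃ : ℝ} (hκ : κ₂ ≠ κ₃)
    (hφ₂ : Real.cos φ₂ - κ₂ * Real.sin φ₂ = 0) (hφ₃ : Real.cos φ₃ - κ₃ * Real.sin φ₃ = 0)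
    (hX : fderiv ℝ h q X = 0) (hX₂ : fderiv ℝ (parallelMap P ν h β φ₂) q X = 0)
    (hX₃ : fderiv ℝ (parallelMap P ν h β φ₃) q X = 0) : X = 0 := by
  obtain ⟨l, m, hlm⟩ := exists_forall_eq_zero_of_three_directions hF
    ((hp.exists_forall_fderiv_parallelMap_eq_zero hq).imp fun X hX => ⟨hX.1, hX.2 φ₂, hX.2 φ₃⟩)
    (hp.exists_fderiv_parallelMap_ne_zero hκ hφ₂ hφ₃ hq hqt)
    ((hp.swap.exists_fderiv_parallelMap_ne_zero hκ.symm hφ₃ hφ₂ hq hqt).imp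
      fun X hX => ⟨hX.1, hX.2.2, hX.2.1⟩)
  exact hlm X hX (by rw [hX₂, map_zero]) (by rw [hX₃, map_zero])

end IsParallelFamily

end ParallelFamily

section TorusChart

variable {F G : Type*} [NormedAddCommGroup F] [NormedSpace ℝ F] [NormedAddCommGroup G]
  [InnerProductSpace ℝ G]

theorem exists_chart_of_coordinates {n : ℕ} [FiniteDimensional ℝ F] (hF : Module.finrank ℝ F = n)
    {U : Set F} (hU : IsOpen U) {q : F} (hq : q ∈ U) {c : Fin n → F → ℝ}
    (hc : ∀ i, ContDiffOn ℝ ∞ (c i) U) (hinj : ∀ X, (∀ i, fderiv ℝ (c i) q X = 0) → X = 0) :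
    ∃ χ : OpenPartialHomeomorph F (E n), q ∈ χ.source ∧ χ.source ⊆ U ∧
      ContDiffOn ℝ ∞ χ χ.source ∧ ContDiffOn ℝ ∞ χ.symm χ.target ∧ ∀ z i, χ z i = c i z := by
  have hf : ContDiffOn ℝ ∞ (fun z => WithLp.toLp 2 (c · z) : F → E n) U :=
    contDiffOn_euclidean.2 hc
  have hinj' : Function.Injective (fderiv ℝ (fun z => WithLp.toLp 2 (c · z) : F → E n) q) := by
    rw [injective_iff_map_eq_zero]
    intro X hX
    refine hinj X fun i => ?_
    have hi : HasFDerivAt (c i) _ q := (EuclideanSpace.proj (𝕜 := ℝ) i).hasFDerivAt.comp q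
      (hasFDerivAt_of_contDiffOn hU hf hq)
    simp [hi.fderiv, hX]
  obtain ⟨χ, ε, -, hqχ, hχU, hχ, -, hsymm⟩ :=
    exists_openPartialHomeomorph_target_eq_ball (by simp [hF]) hU hf hq hinj'
  exact ⟨χ, hqχ, hχU, hχ ▸ hf.mono hχU, hsymm, fun z i => by rw [hχ]⟩

theorem repr_eq_torusMap (b : OrthonormalBasis (Fin 5) ℝ G) {y : G} {α₁ α₂ : ℝ → ℝ} {p : E 3}
    (hy : y = Real.cos (α₁ (p 0)) • (Real.cos (p 1) • b 0 + Real.sin (p 1) • b 1) +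
      Real.sin (α₁ (p 0)) • (Real.cos (p 2) • b 2 + Real.sin (p 2) • b 3) + α₂ (p 0) • b 4) :
    b.repr y = torusMap α₁ α₂ p := by
  rw [hy]
  ext i
  fin_cases i <;> simp [torusMap]

theorem fderiv_eq_zero_of_eq_cos_smul_add_sin_smul {O : Set F} (hO : IsOpen O) {V : F → G}
    {v : F → ℝ} {u w : G} (hv : ContDiffOn ℝ ∞ v O)
    (hV : ∀ z ∈ O, V z = Real.cos (v z) • u + Real.sin (v z) • w)
    {q X : F} (hq : q ∈ O) (hX : fderiv ℝ v q X = 0) : fderiv ℝ V q X = 0 := by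
  have hv' := hasFDerivAt_of_contDiffOn hO hv hq
  have hV' := ((hv'.cos.smul_const u).add (hv'.sin.smul_const w)).congr_of_eventuallyEq
    (Filter.eventually_of_mem (hO.mem_nhds hq) hV)
  simp [hV'.fderiv, hX]

namespace IsParallelFamily

variable {e : G} {J : Set ℝ} {O : Set F} {P ν : F → G} {h : F → ℝ} {β : ℝ → ℝ} {t₀ κ₂ κ₃ : ℝ}

theorem exists_angular_coordinates
    (hp : IsParallelFamily e J O P ν h β t₀ κ₂ κ₃)
    (hF : Module.finrank ℝ F = 3) (hG : Module.finrank ℝ G = 5) (he : ‖e‖ = 1) {q : F} (hq : q ∈ O)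
    (hqt : h q = t₀) (hlt : κ₃ < κ₂) :
    ∃ φ ∈ Set.Ioo 0 (Real.pi / 2), ∃ b : OrthonormalBasis (Fin 5) ℝ G, b 4 = e ∧
      ∃ O' ⊆ O, IsOpen O' ∧ q ∈ O' ∧ ∃ v w : F → ℝ, ContDiffOn ℝ ∞ v O' ∧ ContDiffOn ℝ ∞ w O' ∧
        (∀ z ∈ O', P z = Real.cos (φ + β (h z)) • (Real.cos (v z) • b 0 + Real.sin (v z) • b 1) +
          Real.sin (φ + β (h z)) • (Real.cos (w z) • b 2 + Real.sin (w z) • b 3)) ∧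
        ∀ X, fderiv ℝ h q X = 0 → fderiv ℝ v q X = 0 → fderiv ℝ w q X = 0 → X = 0 := by
  obtain ⟨φ₂, φ₃, hφ₂, hφ₃, hφ₂pos, hφ₃neg, hpos, hltpi⟩ := exists_focal_angles hlt
  obtain ⟨hcos, O₁, hO₁O, hO₁, hq₁, b, hb₄, hb₀, hb₂, hA, hB⟩ :=
    hp.exists_orthogonal_planes hF hG he hq hqt hlt.ne' hφ₂ hφ₃
  have hangle : φ₂ - φ₃ = Real.pi / 2 := Real.injOn_cos ⟨hpos.le, hltpi.le⟩
    ⟨by linarith [Real.pi_pos], by linarith [Real.pi_pos]⟩ (hcos.trans Real.cos_pi_div_two.symm)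
  have hφ₃' : φ₃ = φ₂ - Real.pi / 2 := by linarith
  obtain ⟨O₂, hO₂₁, hO₂, hq₂, v, hv, hAv⟩ := exists_smooth_angle hO₁ hq₁
    ((hp.contDiffOn_parallelMap φ₂).mono hO₁O) (b.norm_eq_one 0) (b.norm_eq_one 1)
    (b.orthonormal.2 (by decide)) (fun z hz => hp.norm_parallelMap φ₂ (hO₁O hz)) hA hb₀.symm
  obtain ⟨O₃, hO₃₂, hO₃, hq₃, w, hw, hBw⟩ := exists_smooth_angle hO₂ hq₂
    ((hp.contDiffOn_parallelMap φ₃).mono (hO₂₁.trans hO₁O)) (b.norm_eq_one 2) (b.norm_eq_one 3)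
    (b.orthonormal.2 (by decide)) (fun z hz => hp.norm_parallelMap φ₃ (hO₁O (hO₂₁ hz)))
    (fun z hz => hB z (hO₂₁ hz)) hb₂.symm
  refine ⟨φ₂, ⟨hφ₂pos, by linarith⟩, b, hb₄, O₃, hO₃₂.trans (hO₂₁.trans hO₁O), hO₃, hq₃, v, w,
    hv.mono hO₃₂, hw, fun z hz => ?_, fun X hX hvX hwX => ?_⟩
  · rw [← hAv z (hO₃₂ hz), ← hBw z hz, hφ₃', cos_smul_parallelMap_add_sin_smul_parallelMap]
  · exact hp.eq_zero_of_fderiv_parallelMap_eq_zero hF hq hqt hlt.ne' hφ₂ hφ₃ hX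
      (fderiv_eq_zero_of_eq_cos_smul_add_sin_smul hO₂ hv hAv hq₂ hvX)
      (fderiv_eq_zero_of_eq_cos_smul_add_sin_smul hO₃ hw hBw hq₃ hwX)

theorem exists_torus_chart_of_lt
    (hp : IsParallelFamily e J O P ν h β t₀ κ₂ κ₃)
    (hF : Module.finrank ℝ F = 3) (hG : Module.finrank ℝ G = 5) (he : ‖e‖ = 1) {q : F} (hq : q ∈ O)
    (hqt : h q = t₀) (hlt : κ₃ < κ₂) :
    ∃ (χ : OpenPartialHomeomorph F (E 3)) (b : OrthonormalBasis (Fin 5) ℝ G) (I : Set ℝ)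
      (α₁ α₂ : ℝ → ℝ), q ∈ χ.source ∧ χ.source ⊆ O ∧ ContDiffOn ℝ ∞ χ χ.source ∧
      ContDiffOn ℝ ∞ χ.symm χ.target ∧ b 4 = e ∧ IsProfile I α₁ α₂ ∧
      ∀ z ∈ χ.source, χ z 0 ∈ I ∧ b.repr (P z + h z • e) = torusMap α₁ α₂ (χ z) := by
  have : FiniteDimensional ℝ F := .of_finrank_pos (by omega)
  obtain ⟨φ, hφ, b, hb₄, O', hO'O, hO', hqO', v, w, hv, hw, hP, hinj⟩ :=
    hp.exists_angular_coordinates hF hG he hq hqt hlt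
  obtain ⟨ψ, ht₀, hψ, hψ', hprofile⟩ := exists_profile hp.isOpen_heights
    (hqt ▸ hp.mapsTo_height hq) (contDiffOn_const.add hp.smooth_distance :
      ContDiffOn ℝ ∞ (fun t => φ + β t) J) (by simpa [hp.distance_eq_zero] using hφ)
  let U := O' ∩ h ⁻¹' ψ.source
  have hh : ContDiffOn ℝ ∞ h O' := hp.smooth_height.mono hO'O
  have hU : IsOpen U := hh.continuousOn.isOpen_inter_preimage hO' ψ.open_source
  have hqU : q ∈ U := ⟨hqO', by rwa [Set.mem_preimage, hqt]⟩
  have hψh : ContDiffOn ℝ ∞ (fun z => ψ (h z)) U :=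
    hψ.comp (hh.mono Set.inter_subset_left) fun z hz => hz.2
  have hvU : ContDiffOn ℝ ∞ v U := hv.mono Set.inter_subset_left
  have hwU : ContDiffOn ℝ ∞ w U := hw.mono Set.inter_subset_left
  have hψh' : fderiv ℝ (fun z => ψ (h z)) q = deriv ψ (h q) • fderiv ℝ h q := by
    have hψq : HasDerivAt ψ (deriv ψ (h q)) (h q) :=
      ((hψ.contDiffAt (ψ.open_source.mem_nhds hqU.2)).differentiableAt (by simp)).hasDerivAt
    exact (hψq.comp_hasFDerivAt q (hasFDerivAt_of_contDiffOn hO' hh hqO')).fderiv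
  obtain ⟨χ, hqχ, hχU, hχ, hsymm, hχc⟩ := exists_chart_of_coordinates hF hU hqU
    (c := ![fun z => ψ (h z), v, w]) (by simp [Fin.forall_fin_succ, hψh, hvU, hwU])
    (fun X hX => by
      simp only [Fin.forall_fin_succ, Matrix.cons_val, hψh', smul_apply, smul_eq_mul,
        mul_eq_zero, hψ' _ hqU.2, false_or] at hX
      exact hinj X hX.1 hX.2.1 hX.2.2.1)
  refine ⟨χ, b, ψ.target, _, ψ.symm, hqχ, fun z hz => hO'O (hχU hz).1, hχ, hsymm,
    hb₄, hprofile, fun z hz => ?_⟩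
  have hzψ : h z ∈ ψ.source := (hχU hz).2
  refine ⟨hχc z 0 ▸ ψ.map_source hzψ, repr_eq_torusMap b ?_⟩
  simp [hχc, ψ.left_inv hzψ, hb₄, hP z (hχU hz).1]

theorem exists_torus_chart
    (hp : IsParallelFamily e J O P ν h β t₀ κ₂ κ₃)
    (hF : Module.finrank ℝ F = 3) (hG : Module.finrank ℝ G = 5) (he : ‖e‖ = 1) {q : F} (hq : q ∈ O)
    (hqt : h q = t₀) (hκ : κ₂ ≠ κ₃) :
    ∃ (χ : OpenPartialHomeomorph F (E 3)) (b : OrthonormalBasis (Fin 5) ℝ G) (I : Set ℝ)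
      (α₁ α₂ : ℝ → ℝ), q ∈ χ.source ∧ χ.source ⊆ O ∧ ContDiffOn ℝ ∞ χ χ.source ∧
      ContDiffOn ℝ ∞ χ.symm χ.target ∧ b 4 = e ∧ IsProfile I α₁ α₂ ∧
      ∀ z ∈ χ.source, χ z 0 ∈ I ∧ b.repr (P z + h z • e) = torusMap α₁ α₂ (χ z) := by
  rcases hκ.lt_or_gt with hlt | hgt
  · exact hp.swap.exists_torus_chart_of_lt hF hG he hq hqt hlt
  · exact hp.exists_torus_chart_of_lt hF hG he hq hqt hgt

end IsParallelFamily

end TorusChart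

section Horizontal

/-- The orthogonal projection of `𝔼⁵ = 𝔼⁴ × ℝ` onto `𝔼⁴ × {0}`. -/
noncomputable def horizontal : E 5 →L[ℝ] E 5 :=
  ContinuousLinearMap.id ℝ (E 5) - (EuclideanSpace.proj 4 : E 5 →L[ℝ] ℝ).smulRight dt

theorem horizontal_apply (y : E 5) : horizontal y = y - y 4 • dt := rfl

theorem outerNormal_eq_horizontal (y : E 5) : outerNormal y = horizontal y := by
  rw [horizontal_apply]
  ext i
  fin_cases i <;> simp [outerNormal, dt]

theorem dt_apply_four : dt 4 = 1 := by simp [dt]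

theorem horizontal_apply_four (y : E 5) : horizontal y 4 = 0 := by
  simp [horizontal_apply, dt_apply_four]

theorem horizontal_dt : horizontal dt = 0 := by
  simp [horizontal_apply, dt_apply_four]

theorem horizontal_horizontal (y : E 5) : horizontal (horizontal y) = horizontal y := by
  rw [horizontal_apply (horizontal y), horizontal_apply_four, zero_smul, sub_zero]

theorem inner_dt_right (y : E 5) : inner ℝ y dt = y 4 := by
  simp [dt, PiLp.inner_apply, Fin.sum_univ_five]

theorem norm_dt : ‖dt‖ = 1 := by
  rw [norm_eq_sqrt_real_inner, inner_dt_right, dt_apply_four, Real.sqrt_one]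

theorem inner_horizontal_left (y w : E 5) :
    inner ℝ (horizontal y) w = inner ℝ y w - y 4 * w 4 := by
  rw [horizontal_apply, inner_sub_left, real_inner_smul_left, real_inner_comm w dt,
    inner_dt_right]

theorem inner_horizontal_horizontal (y w : E 5) :
    inner ℝ (horizontal y) (horizontal w) = inner ℝ y w - y 4 * w 4 := by
  rw [inner_horizontal_left, horizontal_apply_four, mul_zero, sub_zero, real_inner_comm,
    inner_horizontal_left, real_inner_comm, mul_comm]

theorem norm_horizontal_sq (y : E 5) : ‖horizontal y‖ ^ 2 = ‖y‖ ^ 2 - y 4 ^ 2 := by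
  rw [← real_inner_self_eq_norm_sq, inner_horizontal_horizontal,
    real_inner_self_eq_norm_sq, sq (y 4)]

theorem mem_product_iff_norm_horizontal (y : E 5) : y ∈ product ↔ ‖horizontal y‖ = 1 := by
  rw [← pow_eq_one_iff_of_nonneg (norm_nonneg _) two_ne_zero, norm_horizontal_sq,
    EuclideanSpace.norm_sq_eq, Fin.sum_univ_five]
  simp [product]

theorem image_product_of_basis {b : OrthonormalBasis (Fin 5) ℝ (E 5)} (hb : b 4 = dt) :
    b.repr.toAffineIsometryEquiv '' product = product := by
  have hmem : ∀ y, b.repr y ∈ product ↔ y ∈ product := fun y => by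
    rw [mem_product_iff_norm_horizontal, mem_product_iff_norm_horizontal,
      ← pow_eq_one_iff_of_nonneg (norm_nonneg _) two_ne_zero, norm_horizontal_sq,
      b.repr.norm_map, b.repr_apply_apply, hb, real_inner_comm, inner_dt_right,
      ← norm_horizontal_sq, pow_eq_one_iff_of_nonneg (norm_nonneg _) two_ne_zero]
  refine Set.Subset.antisymm (Set.image_subset_iff.2 fun y hy => (hmem y).2 hy) fun y hy => ?_
  exact ⟨b.repr.symm y, (hmem _).1 (by simpa using hy), by simp⟩

end Horizontal

section LocalHypersurface

variable {F G H : Type*} [NormedAddCommGroup F] [NormedSpace ℝ F]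

theorem fderiv_clm_comp_apply [NormedAddCommGroup G] [NormedSpace ℝ G] [NormedAddCommGroup H]
    [NormedSpace ℝ H] {U : Set F} (hU : IsOpen U) (L : G →L[ℝ] H) {f : F → G}
    (hf : ContDiffOn ℝ ∞ f U) {z : F} (hz : z ∈ U) (X : F) :
    fderiv ℝ (fun z => L (f z)) z X = L (fderiv ℝ f z X) :=
  DFunLike.congr_fun (L.hasFDerivAt.comp z (hasFDerivAt_of_contDiffOn hU hf hz)).fderiv X

theorem inner_fderiv_add_inner_fderiv_eq_zero [NormedAddCommGroup G] [InnerProductSpace ℝ G]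
    {U : Set F} (hU : IsOpen U) {V W : F → G} (hV : ContDiffOn ℝ ∞ V U) (hW : ContDiffOn ℝ ∞ W U)
    {c : ℝ} (hc : ∀ z ∈ U, inner ℝ (V z) (W z) = c) {z : F} (hz : z ∈ U) (X : F) :
    inner ℝ (V z) (fderiv ℝ W z X) + inner ℝ (fderiv ℝ V z X) (W z) = 0 := by
  have hconst : (fun z => inner ℝ (V z) (W z)) =ᶠ[nhds z] fun _ => c :=
    Filter.eventually_of_mem (hU.mem_nhds hz) hc
  rw [← fderiv_inner_apply ℝ (hasFDerivAt_of_contDiffOn hU hV hz).differentiableAt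
    (hasFDerivAt_of_contDiffOn hU hW hz).differentiableAt, hconst.fderiv_eq, fderiv_const_apply,
    zero_apply]

theorem inner_fderiv_self_eq_zero [NormedAddCommGroup G] [InnerProductSpace ℝ G]
    {U : Set F} (hU : IsOpen U) {V : F → G} (hV : ContDiffOn ℝ ∞ V U)
    (hnorm : ∀ z ∈ U, ‖V z‖ = 1) {z : F} (hz : z ∈ U) (X : F) :
    inner ℝ (V z) (fderiv ℝ V z X) = 0 := by
  have hsum := inner_fderiv_add_inner_fderiv_eq_zero hU hV hV (c := 1)
    (fun z hz => by rw [real_inner_self_eq_norm_sq, hnorm z hz, one_pow]) hz X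
  rwa [real_inner_comm (V z) (fderiv ℝ V z X), add_self_eq_zero] at hsum

theorem inner_fderiv_normal_symm [NormedAddCommGroup G] [InnerProductSpace ℝ G]
    {U : Set F} (hU : IsOpen U) {x N : F → G} (hx : ContDiffOn ℝ ∞ x U) (hN : ContDiffOn ℝ ∞ N U)
    (horth : ∀ z ∈ U, ∀ X, inner ℝ (N z) (fderiv ℝ x z X) = 0) {z : F} (hz : z ∈ U) (X Y : F) :
    inner ℝ (fderiv ℝ N z X) (fderiv ℝ x z Y) = inner ℝ (fderiv ℝ N z Y) (fderiv ℝ x z X) := by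
  have hdx : ContDiffOn ℝ ∞ (fderiv ℝ x) U := hx.fderiv_of_isOpen hU (by simp)
  have hsecond : ∀ X Y, inner ℝ (fderiv ℝ N z X) (fderiv ℝ x z Y) =
      -inner ℝ (N z) (fderiv ℝ (fderiv ℝ x) z X Y) := fun X Y => by
    have hsum := inner_fderiv_add_inner_fderiv_eq_zero hU hN (hdx.clm_apply contDiffOn_const)
      (fun w hw => horth w hw Y) hz X
    rw [((hasFDerivAt_of_contDiffOn hU hdx hz).clm_apply (hasFDerivAt_const Y z)).fderiv] at hsum
    simp only [ContinuousLinearMap.comp_zero, zero_add, ContinuousLinearMap.flip_apply] at hsum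
    linarith
  have hsymm : IsSymmSndFDerivAt ℝ x z := (hx.contDiffAt (hU.mem_nhds hz)).isSymmSndFDerivAt (by
    rw [minSmoothness_of_isRCLikeNormedField]
    exact WithTop.coe_le_coe.2 le_top)
  rw [hsecond, hsecond, hsymm.eq X Y]

/-- An immersed hypersurface of `𝕊³ × ℝ` with unit normal `N`, parametrized by an open set `U` of
`𝔼³`: the expression of `IsOrientedHypersurface` in a chart. -/
structure IsLocalHypersurface (U : Set (E 3)) (x N : E 3 → E 5) : Prop where
  isOpen : IsOpen U
  smooth : ContDiffOn ℝ ∞ x U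
  smooth_normal : ContDiffOn ℝ ∞ N U
  immersion : ∀ z ∈ U, Function.Injective (fderiv ℝ x z)
  mem_product : ∀ z ∈ U, x z ∈ product
  norm_normal : ∀ z ∈ U, ‖N z‖ = 1
  normal_tangent_product : ∀ z ∈ U, inner ℝ (N z) (outerNormal (x z)) = 0
  normal_orthogonal : ∀ z ∈ U, ∀ X, inner ℝ (N z) (fderiv ℝ x z X) = 0

/-- `T` is the coordinate expression at `z` of the tangential component of `∂/∂t`. -/
def IsHeightVector (x : E 3 → E 5) (z T : E 3) : Prop :=
  ∀ Y, inner ℝ (dt - fderiv ℝ x z T) (fderiv ℝ x z Y) = 0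

/-- `X` is the coordinate expression at `z` of a principal direction `S X = k X`, `X ≠ 0`. -/
structure IsPrincipalVector (x N : E 3 → E 5) (k : ℝ) (z X : E 3) : Prop where
  ne_zero : X ≠ 0
  inner_eq_zero : ∀ Y, inner ℝ (fderiv ℝ N z X + k • fderiv ℝ x z X) (fderiv ℝ x z Y) = 0

namespace IsLocalHypersurface

variable {U : Set (E 3)} {x N : E 3 → E 5} {z T X : E 3} {k k₁ : ℝ}

theorem fderiv_ne_zero (hx : IsLocalHypersurface U x N) (hz : z ∈ U) (hX : X ≠ 0) :
    fderiv ℝ x z X ≠ 0 :=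
  (map_ne_zero_iff _ (hx.immersion z hz)).2 hX

theorem norm_position (hx : IsLocalHypersurface U x N) (hz : z ∈ U) : ‖horizontal (x z)‖ = 1 :=
  (mem_product_iff_norm_horizontal _).1 (hx.mem_product z hz)

theorem inner_normal_position (hx : IsLocalHypersurface U x N) (hz : z ∈ U) :
    inner ℝ (N z) (horizontal (x z)) = 0 := by
  rw [← outerNormal_eq_horizontal, hx.normal_tangent_product z hz]

theorem contDiffOn_position (hx : IsLocalHypersurface U x N) :
    ContDiffOn ℝ ∞ (fun z => horizontal (x z)) U :=
  horizontal.contDiff.comp_contDiffOn hx.smooth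

theorem contDiffOn_height (hx : IsLocalHypersurface U x N) : ContDiffOn ℝ ∞ (fun z => x z 4) U :=
  (EuclideanSpace.proj 4 : E 5 →L[ℝ] ℝ).contDiff.comp_contDiffOn hx.smooth

theorem contDiffOn_angle (hx : IsLocalHypersurface U x N) : ContDiffOn ℝ ∞ (fun z => N z 4) U :=
  (EuclideanSpace.proj 4 : E 5 →L[ℝ] ℝ).contDiff.comp_contDiffOn hx.smooth_normal

theorem fderiv_position (hx : IsLocalHypersurface U x N) (hz : z ∈ U) (X : E 3) :
    fderiv ℝ (fun z => horizontal (x z)) z X = horizontal (fderiv ℝ x z X) :=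
  fderiv_clm_comp_apply hx.isOpen horizontal hx.smooth hz X

theorem fderiv_height (hx : IsLocalHypersurface U x N) (hz : z ∈ U) (X : E 3) :
    fderiv ℝ (fun z => x z 4) z X = fderiv ℝ x z X 4 :=
  fderiv_clm_comp_apply hx.isOpen (EuclideanSpace.proj 4 : E 5 →L[ℝ] ℝ) hx.smooth hz X

theorem fderiv_angle (hx : IsLocalHypersurface U x N) (hz : z ∈ U) (X : E 3) :
    fderiv ℝ (fun z => N z 4) z X = fderiv ℝ N z X 4 :=
  fderiv_clm_comp_apply hx.isOpen (EuclideanSpace.proj 4 : E 5 →L[ℝ] ℝ) hx.smooth_normal hz X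

theorem inner_position_fderiv (hx : IsLocalHypersurface U x N) (hz : z ∈ U) (X : E 3) :
    inner ℝ (horizontal (x z)) (fderiv ℝ x z X) = 0 := by
  have hself := inner_fderiv_self_eq_zero hx.isOpen hx.contDiffOn_position
    (fun z hz => hx.norm_position hz) hz X
  rwa [hx.fderiv_position hz, inner_horizontal_horizontal, ← inner_horizontal_left] at hself

theorem inner_position_fderiv_normal (hx : IsLocalHypersurface U x N) (hz : z ∈ U) (X : E 3) :
    inner ℝ (horizontal (x z)) (fderiv ℝ N z X) = N z 4 * fderiv ℝ x z X 4 := by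
  have hsum := inner_fderiv_add_inner_fderiv_eq_zero hx.isOpen hx.smooth_normal
    hx.contDiffOn_position (fun z hz => hx.inner_normal_position hz) hz X
  rw [hx.fderiv_position hz, real_inner_comm, inner_horizontal_left, real_inner_comm,
    hx.normal_orthogonal z hz, real_inner_comm] at hsum
  linarith

theorem eq_of_orthogonal (hx : IsLocalHypersurface U x N) (hz : z ∈ U) {v : E 5}
    (hv : ∀ Y, inner ℝ v (fderiv ℝ x z Y) = 0) :
    v = inner ℝ (N z) v • N z + inner ℝ (horizontal (x z)) v • horizontal (x z) := by
  have hmem : ∀ {w : E 5}, (∀ Y, inner ℝ w (fderiv ℝ x z Y) = 0) →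
      w ∈ (LinearMap.range (fderiv ℝ x z).toLinearMap)ᗮ := fun hw =>
    (Submodule.mem_orthogonal' _ _).2 (by rintro _ ⟨Y, rfl⟩; exact hw Y)
  refine eq_inner_smul_add_of_mem_orthogonal ?_ (hx.norm_normal z hz) (hx.norm_position hz)
    (hx.inner_normal_position hz) (hmem (hx.normal_orthogonal z hz))
    (hmem (hx.inner_position_fderiv hz)) (hmem hv)
  rw [LinearMap.finrank_range_of_inj (hx.immersion z hz)]
  simp

theorem fderiv_of_isHeightVector (hx : IsLocalHypersurface U x N) (hz : z ∈ U)
    (hT : IsHeightVector x z T) : fderiv ℝ x z T = dt - N z 4 • N z := by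
  have hdecomp := hx.eq_of_orthogonal hz hT
  rw [inner_sub_right, inner_sub_right, inner_dt_right, inner_dt_right, horizontal_apply_four,
    hx.normal_orthogonal z hz, hx.inner_position_fderiv hz, sub_zero, sub_zero, zero_smul,
    add_zero] at hdecomp
  rw [← hdecomp, sub_sub_cancel]

theorem fderiv_normal_of_isPrincipalVector (hx : IsLocalHypersurface U x N) (hz : z ∈ U)
    (hX : IsPrincipalVector x N k z X) :
    fderiv ℝ N z X = -k • fderiv ℝ x z X + (N z 4 * fderiv ℝ x z X 4) • horizontal (x z) := by
  have hdecomp := hx.eq_of_orthogonal hz hX.inner_eq_zero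
  rw [inner_add_right, inner_add_right, real_inner_smul_right, real_inner_smul_right,
    inner_fderiv_self_eq_zero hx.isOpen hx.smooth_normal hx.norm_normal hz,
    hx.normal_orthogonal z hz, hx.inner_position_fderiv hz, hx.inner_position_fderiv_normal hz,
    mul_zero, add_zero, zero_smul, zero_add, add_zero] at hdecomp
  rw [← hdecomp]
  module

theorem fderiv_height_of_isHeightVector (hx : IsLocalHypersurface U x N) (hz : z ∈ U)
    (hT : IsHeightVector x z T) : fderiv ℝ x z T 4 = 1 - N z 4 ^ 2 := by
  simp [hx.fderiv_of_isHeightVector hz hT, dt_apply_four, sq]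

theorem angle_sq_lt_one (hx : IsLocalHypersurface U x N) (hz : z ∈ U)
    (hT : IsHeightVector x z T) (hT₀ : T ≠ 0) : N z 4 ^ 2 < 1 := by
  have hpos := real_inner_self_pos.2 (hx.fderiv_ne_zero hz hT₀)
  have hself := hT T
  rw [inner_sub_left, real_inner_comm, inner_dt_right, hx.fderiv_height_of_isHeightVector hz hT]
    at hself
  linarith

/-- The symmetry of the second fundamental form in `T` and `X`, where `⟪dx T, ·⟫ = dh` on tangent
vectors and `⟪dN X, dx T⟫ = dσ X`. -/
theorem fderiv_angle_eq (hx : IsLocalHypersurface U x N) (hz : z ∈ U)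
    (hT : IsHeightVector x z T) (hk₁ : IsPrincipalVector x N k₁ z T) (X : E 3) :
    fderiv ℝ N z X 4 = -k₁ * fderiv ℝ x z X 4 := by
  have hinner : ∀ v, inner ℝ (fderiv ℝ x z T) v = v 4 - N z 4 * inner ℝ (N z) v := fun v => by
    rw [hx.fderiv_of_isHeightVector hz hT, inner_sub_left, real_inner_smul_left, real_inner_comm,
      inner_dt_right]
  have hsymm := inner_fderiv_normal_symm hx.isOpen hx.smooth hx.smooth_normal hx.normal_orthogonal
    hz X T
  have hprincipal := hk₁.inner_eq_zero X
  rw [inner_add_left, real_inner_smul_left, ← hsymm, real_inner_comm, hinner, hinner,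
    inner_fderiv_self_eq_zero hx.isOpen hx.smooth_normal hx.norm_normal hz,
    hx.normal_orthogonal z hz] at hprincipal
  linarith

theorem fderiv_height_of_isPrincipalVector (hx : IsLocalHypersurface U x N) (hz : z ∈ U)
    (hT : IsHeightVector x z T) (hk₁ : IsPrincipalVector x N k₁ z T) (hk : k₁ ≠ k)
    (hX : IsPrincipalVector x N k z X) : fderiv ℝ x z X 4 = 0 := by
  have hfour := congrArg (fun v : E 5 => v 4) (hx.fderiv_normal_of_isPrincipalVector hz hX)
  simp only [PiLp.add_apply, PiLp.smul_apply, horizontal_apply_four, smul_eq_mul, mul_zero,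
    add_zero, hx.fderiv_angle_eq hz hT hk₁] at hfour
  refine (mul_eq_zero.1 (?_ : (k₁ - k) * fderiv ℝ x z X 4 = 0)).resolve_left (sub_ne_zero.2 hk)
  linarith

end IsLocalHypersurface

end LocalHypersurface

section ParallelSlices

/-- The unit normal in `𝕊³` of the slices `h = const` of a hypersurface of `𝕊³ × ℝ`, as a function
of the unit normal `n` of the hypersurface: the normalized horizontal part of `n`. -/
noncomputable def sliceNormal (n : E 5) : E 5 := (√(1 - n 4 ^ 2))⁻¹ • horizontal n

theorem hasDerivAt_inv_sqrt_one_sub_sq {s : ℝ} (hs : s ^ 2 < 1) :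
    HasDerivAt (fun s => (√(1 - s ^ 2))⁻¹) (s * (√(1 - s ^ 2))⁻¹ ^ 3) s := by
  have hpos : 0 < √(1 - s ^ 2) := Real.sqrt_pos.2 (sub_pos.2 hs)
  have hderiv := (((hasDerivAt_pow 2 s).const_sub 1).sqrt (sub_pos.2 hs).ne').inv hpos.ne'
  refine hderiv.congr_deriv ?_
  field_simp
  norm_num

theorem contDiffAt_sliceNormal {n : E 5} (hn : n 4 ^ 2 < 1) : ContDiffAt ℝ ∞ sliceNormal n := by
  have hfour : ContDiffAt ℝ ∞ (fun n : E 5 => n 4) n :=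
    (EuclideanSpace.proj 4 : E 5 →L[ℝ] ℝ).contDiff.contDiffAt
  have hpos : 0 < 1 - n 4 ^ 2 := sub_pos.2 hn
  exact (((contDiffAt_const.sub (hfour.pow 2)).sqrt hpos.ne').inv (Real.sqrt_pos.2 hpos).ne').smul
    horizontal.contDiff.contDiffAt

theorem fderiv_sliceNormal {n : E 5} (hn : n 4 ^ 2 < 1) (v : E 5) :
    fderiv ℝ sliceNormal n v = (n 4 * (√(1 - n 4 ^ 2))⁻¹ ^ 3 * v 4) • horizontal n +
      (√(1 - n 4 ^ 2))⁻¹ • horizontal v := by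
  have hfour : HasFDerivAt (fun n : E 5 => n 4) (EuclideanSpace.proj 4 : E 5 →L[ℝ] ℝ) n :=
    (EuclideanSpace.proj 4 : E 5 →L[ℝ] ℝ).hasFDerivAt
  have hfactor := (hasDerivAt_inv_sqrt_one_sub_sq hn).comp_hasFDerivAt n hfour
  have hderiv : HasFDerivAt sliceNormal _ n := hfactor.smul horizontal.hasFDerivAt
  rw [hderiv.fderiv, add_comm]
  rfl

theorem norm_sliceNormal {n : E 5} (hn : ‖n‖ = 1) (hn₄ : n 4 ^ 2 < 1) : ‖sliceNormal n‖ = 1 := by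
  have hnorm : ‖horizontal n‖ = √(1 - n 4 ^ 2) := by
    rw [← Real.sqrt_sq (norm_nonneg (horizontal n)), norm_horizontal_sq, hn, one_pow]
  rw [sliceNormal, norm_smul, norm_inv, Real.norm_of_nonneg (Real.sqrt_nonneg _), hnorm,
    inv_mul_cancel₀ (Real.sqrt_pos.2 (sub_pos.2 hn₄)).ne']

namespace IsLocalHypersurface

variable {U : Set (E 3)} {x N : E 3 → E 5} {z T X : E 3} {k k₁ : ℝ}

theorem inner_position_sliceNormal (hx : IsLocalHypersurface U x N) (hz : z ∈ U) :
    inner ℝ (horizontal (x z)) (sliceNormal (N z)) = 0 := by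
  rw [sliceNormal, real_inner_smul_right, real_inner_comm, inner_horizontal_left,
    hx.inner_normal_position hz, horizontal_apply_four, mul_zero, sub_zero, mul_zero]

theorem fderiv_sliceNormal_comp (hx : IsLocalHypersurface U x N) (hz : z ∈ U)
    (hσ : N z 4 ^ 2 < 1) (X : E 3) :
    fderiv ℝ (fun z => sliceNormal (N z)) z X =
      (N z 4 * (√(1 - N z 4 ^ 2))⁻¹ ^ 3 * fderiv ℝ N z X 4) • horizontal (N z) +
        (√(1 - N z 4 ^ 2))⁻¹ • horizontal (fderiv ℝ N z X) := by
  have hν := ((contDiffAt_sliceNormal hσ).differentiableAt (by simp)).hasFDerivAt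
  rw [← fderiv_sliceNormal hσ]
  exact DFunLike.congr_fun
    (hν.comp z (hasFDerivAt_of_contDiffOn hx.isOpen hx.smooth_normal hz)).fderiv X

theorem horizontal_fderiv_of_isHeightVector (hx : IsLocalHypersurface U x N) (hz : z ∈ U)
    (hT : IsHeightVector x z T) : horizontal (fderiv ℝ x z T) = -N z 4 • horizontal (N z) := by
  rw [hx.fderiv_of_isHeightVector hz hT, map_sub, map_smul, horizontal_dt, zero_sub, neg_smul]

theorem fderiv_position_of_isHeightVector (hx : IsLocalHypersurface U x N) (hz : z ∈ U)
    (hσ : N z 4 ^ 2 < 1) (hT : IsHeightVector x z T) :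
    fderiv ℝ (fun z => horizontal (x z)) z T =
      -(N z 4 / √(1 - N z 4 ^ 2) * fderiv ℝ (fun z => x z 4) z T) • sliceNormal (N z) := by
  have hpos : 0 < 1 - N z 4 ^ 2 := sub_pos.2 hσ
  have hsqrt := (Real.sqrt_pos.2 hpos).ne'
  rw [hx.fderiv_position hz, hx.horizontal_fderiv_of_isHeightVector hz hT, hx.fderiv_height hz,
    hx.fderiv_height_of_isHeightVector hz hT, sliceNormal, smul_smul]
  congr 1
  field_simp
  rw [Real.sq_sqrt hpos.le]

theorem fderiv_sliceNormal_of_isHeightVector (hx : IsLocalHypersurface U x N) (hz : z ∈ U)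
    (hT : IsHeightVector x z T) (hk₁ : IsPrincipalVector x N k₁ z T) :
    fderiv ℝ (fun z => sliceNormal (N z)) z T =
      (N z 4 / √(1 - N z 4 ^ 2) * fderiv ℝ (fun z => x z 4) z T) • horizontal (x z) := by
  have hσ := hx.angle_sq_lt_one hz hT hk₁.ne_zero
  have hpos : 0 < 1 - N z 4 ^ 2 := sub_pos.2 hσ
  have hsqrt := (Real.sqrt_pos.2 hpos).ne'
  have hcancel : N z 4 * (√(1 - N z 4 ^ 2))⁻¹ ^ 3 * (-k₁ * (1 - N z 4 ^ 2)) +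
      (√(1 - N z 4 ^ 2))⁻¹ * (k₁ * N z 4) = 0 := by
    nth_rewrite 2 [← Real.sq_sqrt hpos.le]
    field_simp
    ring
  rw [hx.fderiv_sliceNormal_comp hz hσ, hx.fderiv_angle_eq hz hT hk₁,
    hx.fderiv_normal_of_isPrincipalVector hz hk₁, map_add, map_smul, map_smul,
    horizontal_horizontal, hx.horizontal_fderiv_of_isHeightVector hz hT, hx.fderiv_height hz,
    hx.fderiv_height_of_isHeightVector hz hT]
  linear_combination (norm := module) hcancel • horizontal (N z)

theorem fderiv_sliceNormal_of_isPrincipalVector (hx : IsLocalHypersurface U x N) (hz : z ∈ U)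
    (hT : IsHeightVector x z T) (hk₁ : IsPrincipalVector x N k₁ z T) (hk : k₁ ≠ k)
    (hX : IsPrincipalVector x N k z X) :
    fderiv ℝ (fun z => sliceNormal (N z)) z X =
      -(k / √(1 - N z 4 ^ 2)) • fderiv ℝ (fun z => horizontal (x z)) z X := by
  have hheight := hx.fderiv_height_of_isPrincipalVector hz hT hk₁ hk hX
  rw [hx.fderiv_sliceNormal_comp hz (hx.angle_sq_lt_one hz hT hk₁.ne_zero),
    hx.fderiv_angle_eq hz hT hk₁, hx.fderiv_normal_of_isPrincipalVector hz hX, hheight,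
    hx.fderiv_position hz, mul_zero, mul_zero, mul_zero, zero_smul, zero_smul, zero_add, add_zero,
    map_smul, smul_smul]
  congr 1
  ring

theorem fderiv_position_ne_zero (hx : IsLocalHypersurface U x N) (hz : z ∈ U) (hX : X ≠ 0)
    (hheight : fderiv ℝ x z X 4 = 0) : fderiv ℝ (fun z => horizontal (x z)) z X ≠ 0 := by
  rw [hx.fderiv_position hz, horizontal_apply, hheight, zero_smul, sub_zero]
  exact hx.fderiv_ne_zero hz hX

theorem exists_angle_eq_comp_height (hx : IsLocalHypersurface U x N) {k₁ : E 3 → ℝ}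
    (hT : ∀ z ∈ U, ∃ T, IsHeightVector x z T ∧ IsPrincipalVector x N (k₁ z) z T) {q : E 3}
    (hq : q ∈ U) :
    ∃ (ε : ℝ) (f : ℝ → ℝ) (O : Set (E 3)), ContDiffOn ℝ ∞ f (Metric.ball (x q 4) ε) ∧
      (∀ t ∈ Metric.ball (x q 4) ε, f t ^ 2 < 1) ∧ IsOpen O ∧ O ⊆ U ∧ q ∈ O ∧
      ∀ z ∈ O, x z 4 ∈ Metric.ball (x q 4) ε ∧ N z 4 = f (x z 4) := by
  obtain ⟨T, hTq, hk₁q⟩ := hT q hq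
  have hσq : N q 4 ^ 2 < 1 := hx.angle_sq_lt_one hq hTq hk₁q.ne_zero
  have hsurj : Function.Surjective (fderiv ℝ (fun z => x z 4) q) := by
    refine LinearMap.surjective (f := (fderiv ℝ (fun z => x z 4) q).toLinearMap) fun hzero => ?_
    have hheight := DFunLike.congr_fun hzero T
    rw [ContinuousLinearMap.coe_coe, hx.fderiv_height hq,
      hx.fderiv_height_of_isHeightVector hq hTq] at hheight
    exact (sub_pos.2 hσq).ne' hheight
  obtain ⟨ε, f, hε, hf, hev⟩ := exists_eventually_eq_comp_of_ker_fderiv_le hx.isOpen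
    hx.contDiffOn_angle hx.contDiffOn_height hq hsurj fun z hz X hX => by
      obtain ⟨T, hT, hk₁⟩ := hT z hz
      rw [hx.fderiv_angle hz, hx.fderiv_angle_eq hz hT hk₁, ← hx.fderiv_height hz, hX, mul_zero]
  have hfq : f (x q 4) ^ 2 < 1 := hev.self_of_nhds.2 ▸ hσq
  have hfcont : ContinuousAt f (x q 4) := hf.continuousOn.continuousAt (Metric.ball_mem_nhds _ hε)
  obtain ⟨δ, hδ, hfδ⟩ := Metric.eventually_nhds_iff_ball.1
    ((hfcont.pow 2).eventually_lt_const hfq)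
  have hsub : Metric.ball (x q 4) (min ε δ) ⊆ Metric.ball (x q 4) ε :=
    Metric.ball_subset_ball (min_le_left _ _)
  have hhcont : ContinuousAt (fun z => x z 4) q :=
    hx.contDiffOn_height.continuousOn.continuousAt (hx.isOpen.mem_nhds hq)
  have hnear := (hhcont.eventually_mem (Metric.ball_mem_nhds _ (lt_min hε hδ))).and
    (hev.and (hx.isOpen.mem_nhds hq))
  obtain ⟨O, hO, hOopen, hqO⟩ := eventually_nhds_iff.1 hnear
  exact ⟨min ε δ, f, O, hf.mono hsub,
    fun t ht => hfδ t (Metric.ball_subset_ball (min_le_right _ _) ht), hOopen,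
    fun z hz => (hO z hz).2.2, hqO, fun z hz => ⟨(hO z hz).1, (hO z hz).2.1.2⟩⟩

theorem principalCurvature_eq_neg_deriv (hx : IsLocalHypersurface U x N) {O : Set (E 3)}
    (hO : IsOpen O) (hOU : O ⊆ U) (hz : z ∈ O) (hT : IsHeightVector x z T)
    (hk₁ : IsPrincipalVector x N k₁ z T) {f : ℝ → ℝ} (hf : DifferentiableAt ℝ f (x z 4))
    (hσ : ∀ w ∈ O, N w 4 = f (x w 4)) : k₁ = -deriv f (x z 4) := by
  have hzU := hOU hz
  have heq : (fun w => N w 4) =ᶠ[nhds z] f ∘ fun w => x w 4 :=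
    Filter.eventually_of_mem (hO.mem_nhds hz) hσ
  have hh := hasFDerivAt_of_contDiffOn hx.isOpen hx.contDiffOn_height hzU
  have hchain : fderiv ℝ N z T 4 = deriv f (x z 4) * fderiv ℝ x z T 4 := by
    rw [← hx.fderiv_angle hzU, ← hx.fderiv_height hzU, heq.fderiv_eq,
      (hf.hasDerivAt.comp_hasFDerivAt z hh).fderiv]
    rfl
  rw [hx.fderiv_angle_eq hzU hT hk₁] at hchain
  have hpos : fderiv ℝ x z T 4 ≠ 0 := by
    rw [hx.fderiv_height_of_isHeightVector hzU hT]
    exact (sub_pos.2 (hx.angle_sq_lt_one hzU hT hk₁.ne_zero)).ne'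
  rw [← mul_right_cancel₀ hpos hchain, neg_neg]

theorem principalCurvature_eq_of_height_eq (hx : IsLocalHypersurface U x N) {O : Set (E 3)}
    (hO : IsOpen O) (hOU : O ⊆ U) {k₁ : E 3 → ℝ}
    (hT : ∀ z ∈ U, ∃ T, IsHeightVector x z T ∧ IsPrincipalVector x N (k₁ z) z T) {J : Set ℝ}
    (hJ : IsOpen J) {f : ℝ → ℝ} (hf : ContDiffOn ℝ ∞ f J)
    (hσ : ∀ z ∈ O, x z 4 ∈ J ∧ N z 4 = f (x z 4)) {w : E 3} (hz : z ∈ O) (hw : w ∈ O)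
    (hzw : x z 4 = x w 4) : k₁ z = k₁ w := by
  have hcurvature : ∀ z ∈ O, k₁ z = -deriv f (x z 4) := fun z hz => by
    obtain ⟨T, hT, hk₁⟩ := hT z (hOU hz)
    exact hx.principalCurvature_eq_neg_deriv hO hOU hz hT hk₁
      ((hf.differentiableOn (by simp)).differentiableAt (hJ.mem_nhds (hσ z hz).1))
      fun w hw => (hσ w hw).2
  rw [hcurvature z hz, hcurvature w hw, hzw]

theorem exists_transverse_slice (hx : IsLocalHypersurface U x N) (hz : z ∈ U)
    (hT : IsHeightVector x z T) (hk₁ : IsPrincipalVector x N k₁ z T) :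
    ∃ X, fderiv ℝ (fun z => x z 4) z X ≠ 0 ∧
      fderiv ℝ (fun z => horizontal (x z)) z X =
        -(N z 4 / √(1 - N z 4 ^ 2) * fderiv ℝ (fun z => x z 4) z X) • sliceNormal (N z) ∧
      fderiv ℝ (fun z => sliceNormal (N z)) z X =
        (N z 4 / √(1 - N z 4 ^ 2) * fderiv ℝ (fun z => x z 4) z X) • horizontal (x z) := by
  have hσ := hx.angle_sq_lt_one hz hT hk₁.ne_zero
  refine ⟨T, ?_, hx.fderiv_position_of_isHeightVector hz hσ hT,
    hx.fderiv_sliceNormal_of_isHeightVector hz hT hk₁⟩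
  rw [hx.fderiv_height hz, hx.fderiv_height_of_isHeightVector hz hT]
  exact (sub_pos.2 hσ).ne'

theorem exists_principal_slice (hx : IsLocalHypersurface U x N) (hz : z ∈ U)
    (hT : IsHeightVector x z T) (hk₁ : IsPrincipalVector x N k₁ z T) (hk : k₁ ≠ k)
    (hX : IsPrincipalVector x N k z X) :
    ∃ X, fderiv ℝ (fun z => x z 4) z X = 0 ∧ fderiv ℝ (fun z => horizontal (x z)) z X ≠ 0 ∧
      fderiv ℝ (fun z => sliceNormal (N z)) z X =
        -(k / √(1 - N z 4 ^ 2)) • fderiv ℝ (fun z => horizontal (x z)) z X := by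
  have hheight := hx.fderiv_height_of_isPrincipalVector hz hT hk₁ hk hX
  exact ⟨X, (hx.fderiv_height hz X).trans hheight, hx.fderiv_position_ne_zero hz hX.ne_zero hheight,
    hx.fderiv_sliceNormal_of_isPrincipalVector hz hT hk₁ hk hX⟩

end IsLocalHypersurface

theorem exists_distance {f : ℝ → ℝ} {a ε : ℝ} (hf : ContDiffOn ℝ ∞ f (Metric.ball a ε))
    (hf₁ : ∀ t ∈ Metric.ball a ε, f t ^ 2 < 1) :
    ∃ β : ℝ → ℝ, β a = 0 ∧ ContDiffOn ℝ ∞ β (Metric.ball a ε) ∧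
      ∀ t ∈ Metric.ball a ε, deriv β t = f t / √(1 - f t ^ 2) := by
  obtain ⟨β, hβa, hβ, hβ'⟩ := exists_primitive (hf.div
    ((contDiffOn_const.sub (hf.pow 2)).sqrt fun t ht => (sub_pos.2 (hf₁ t ht)).ne')
    fun t ht => (Real.sqrt_pos.2 (sub_pos.2 (hf₁ t ht))).ne')
  exact ⟨β, hβa, hβ, fun t ht => (hβ' t ht).deriv⟩

theorem IsLocalHypersurface.exists_isParallelFamily {U : Set (E 3)} {x N : E 3 → E 5}
    (hx : IsLocalHypersurface U x N) {k₁ k₂ k₃ : E 3 → ℝ}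
    (hT : ∀ z ∈ U, ∃ T, IsHeightVector x z T ∧ IsPrincipalVector x N (k₁ z) z T)
    (hk₂ : ∀ z ∈ U, ∃ X, IsPrincipalVector x N (k₂ z) z X)
    (hk₃ : ∀ z ∈ U, ∃ X, IsPrincipalVector x N (k₃ z) z X)
    (h₁₂ : ∀ z ∈ U, k₁ z ≠ k₂ z) (h₁₃ : ∀ z ∈ U, k₁ z ≠ k₃ z) {f₁ f₂ : ℝ → ℝ}
    (hf₁ : ∀ z ∈ U, k₂ z = f₁ (k₁ z)) (hf₂ : ∀ z ∈ U, k₃ z = f₂ (k₁ z)) {q : E 3} (hq : q ∈ U) :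
    ∃ J O β, q ∈ O ∧ O ⊆ U ∧
      IsParallelFamily dt J O (fun z => horizontal (x z)) (fun z => sliceNormal (N z))
        (fun z => x z 4) β (x q 4) (k₂ q / √(1 - N q 4 ^ 2)) (k₃ q / √(1 - N q 4 ^ 2)) := by
  obtain ⟨ε, f, O, hf, hf_lt, hO, hOU, hqO, hσ⟩ := hx.exists_angle_eq_comp_height hT hq
  obtain ⟨β, hβ₀, hβ, hβ'⟩ := exists_distance hf hf_lt
  have hσ_lt : ∀ z ∈ O, N z 4 ^ 2 < 1 := fun z hz => (hσ z hz).2 ▸ hf_lt _ (hσ z hz).1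
  have hσ_slice : ∀ z ∈ O, x z 4 = x q 4 → N q 4 = N z 4 := fun z hz hzq => by
    rw [(hσ z hz).2, (hσ q hqO).2, hzq]
  have hk_slice : ∀ {k : E 3 → ℝ} {g : ℝ → ℝ}, (∀ z ∈ U, k z = g (k₁ z)) → ∀ z ∈ O,
      x z 4 = x q 4 → k q = k z := fun hg z hz hzq => by
    rw [hg q hq, hg z (hOU hz), hx.principalCurvature_eq_of_height_eq hO hOU hT
      Metric.isOpen_ball hf hσ hz hqO hzq]
  exact ⟨Metric.ball (x q 4) ε, O, β, hqO, hOU, {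
    isOpen_heights := Metric.isOpen_ball
    isOpen_domain := hO
    mapsTo_height := fun z hz => (hσ z hz).1
    smooth_height := hx.contDiffOn_height.mono hOU
    smooth_position := hx.contDiffOn_position.mono hOU
    smooth_normal := fun z hz => (contDiffAt_sliceNormal (hσ_lt z hz)).comp_contDiffWithinAt z
      (hx.smooth_normal.mono hOU z hz)
    smooth_distance := hβ
    distance_eq_zero := hβ₀
    norm_position := fun z hz => hx.norm_position (hOU hz)
    norm_normal := fun z hz => norm_sliceNormal (hx.norm_normal z (hOU hz)) (hσ_lt z hz)
    inner_position_normal := fun z hz => hx.inner_position_sliceNormal (hOU hz)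
    inner_position_axis := fun z _ => by rw [inner_dt_right, horizontal_apply_four]
    inner_normal_axis := fun z _ => by
      rw [inner_dt_right, sliceNormal, PiLp.smul_apply, horizontal_apply_four, smul_zero]
    transverse := fun z hz => by
      obtain ⟨T, hT, hk₁⟩ := hT z (hOU hz)
      rw [hβ' _ (hσ z hz).1, ← (hσ z hz).2]
      exact hx.exists_transverse_slice (hOU hz) hT hk₁
    principal₂ := fun z hz hzq => by
      obtain ⟨T, hT, hk₁⟩ := hT z (hOU hz)
      obtain ⟨X, hX⟩ := hk₂ z (hOU hz)
      rw [hk_slice hf₁ z hz hzq, hσ_slice z hz hzq]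
      exact hx.exists_principal_slice (hOU hz) hT hk₁ (h₁₂ z (hOU hz)) hX
    principal₃ := fun z hz hzq => by
      obtain ⟨T, hT, hk₁⟩ := hT z (hOU hz)
      obtain ⟨X, hX⟩ := hk₃ z (hOU hz)
      rw [hk_slice hf₂ z hz hzq, hσ_slice z hz hzq]
      exact hx.exists_principal_slice (hOU hz) hT hk₁ (h₁₃ z (hOU hz)) hX }⟩

theorem IsLocalHypersurface.exists_torus_chart {U : Set (E 3)} {x N : E 3 → E 5}
    (hx : IsLocalHypersurface U x N) {k₁ k₂ k₃ : E 3 → ℝ}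
    (hT : ∀ z ∈ U, ∃ T, IsHeightVector x z T ∧ IsPrincipalVector x N (k₁ z) z T)
    (hk₂ : ∀ z ∈ U, ∃ X, IsPrincipalVector x N (k₂ z) z X)
    (hk₃ : ∀ z ∈ U, ∃ X, IsPrincipalVector x N (k₃ z) z X)
    (h₁₂ : ∀ z ∈ U, k₁ z ≠ k₂ z) (h₁₃ : ∀ z ∈ U, k₁ z ≠ k₃ z) {f₁ f₂ : ℝ → ℝ}
    (hf₁ : ∀ z ∈ U, k₂ z = f₁ (k₁ z)) (hf₂ : ∀ z ∈ U, k₃ z = f₂ (k₁ z)) {q : E 3} (hq : q ∈ U)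
    (h₂₃ : k₂ q ≠ k₃ q) :
    ∃ (χ : OpenPartialHomeomorph (E 3) (E 3)) (b : OrthonormalBasis (Fin 5) ℝ (E 5)) (I : Set ℝ)
      (α₁ α₂ : ℝ → ℝ), q ∈ χ.source ∧ χ.source ⊆ U ∧ ContDiffOn ℝ ∞ χ χ.source ∧
      ContDiffOn ℝ ∞ χ.symm χ.target ∧ b 4 = dt ∧ IsProfile I α₁ α₂ ∧
      ∀ z ∈ χ.source, χ z 0 ∈ I ∧ b.repr (x z) = torusMap α₁ α₂ (χ z) := by
  obtain ⟨J, O, β, hqO, hOU, hfamily⟩ :=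
    hx.exists_isParallelFamily hT hk₂ hk₃ h₁₂ h₁₃ hf₁ hf₂ hq
  obtain ⟨T, hTq, hk₁q⟩ := hT q hq
  have hsqrt : √(1 - N q 4 ^ 2) ≠ 0 :=
    (Real.sqrt_pos.2 (sub_pos.2 (hx.angle_sq_lt_one hq hTq hk₁q.ne_zero))).ne'
  obtain ⟨χ, b, I, α₁, α₂, hqχ, hχO, hχ, hχ_symm, hb, hprofile, htorus⟩ :=
    hfamily.exists_torus_chart (by simp) (by simp) norm_dt hqO rfl
      ((div_left_inj' hsqrt).not.2 h₂₃)
  refine ⟨χ, b, I, α₁, α₂, hqχ, hχO.trans hOU, hχ, hχ_symm, hb, hprofile, fun z hz => ?_⟩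
  have hdecomp : horizontal (x z) + x z 4 • dt = x z := sub_add_cancel _ _
  exact hdecomp ▸ htorus z hz

end ParallelSlices

section Manifold

theorem trans_mem_maximalAtlas {V M : Type*} [NormedAddCommGroup V] [NormedSpace ℝ V]
    [TopologicalSpace M] [ChartedSpace V M] [IsManifold 𝓘(ℝ, V) ∞ M]
    {φ : OpenPartialHomeomorph M V} (hφ : φ ∈ IsManifold.maximalAtlas 𝓘(ℝ, V) ∞ M)
    {χ : OpenPartialHomeomorph V V} (hχ : ContDiffOn ℝ ∞ χ χ.source)
    (hχ_symm : ContDiffOn ℝ ∞ χ.symm χ.target) :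
    φ.trans χ ∈ IsManifold.maximalAtlas 𝓘(ℝ, V) ∞ M := by
  refine OpenPartialHomeomorph.mem_maximalAtlas_of_contMDiffOn _ ?_ ?_
  · rw [OpenPartialHomeomorph.coe_trans, OpenPartialHomeomorph.trans_source]
    exact hχ.contMDiffOn.comp ((contMDiffOn_of_mem_maximalAtlas hφ).mono Set.inter_subset_left)
      fun q hq => hq.2
  · rw [OpenPartialHomeomorph.coe_trans_symm, OpenPartialHomeomorph.trans_target]
    exact (contMDiffOn_symm_of_mem_maximalAtlas hφ).comp
      (hχ_symm.contMDiffOn.mono Set.inter_subset_left) fun q hq => hq.2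

variable {M : Type*} [TopologicalSpace M] [ChartedSpace (E 3) M]

theorem inner_sub_diff_tangentPart {x : M → E 5} {p : M} (h : Function.Injective (diff x p))
    (v : E 5) (Y : TangentSpace (𝓡 3) p) :
    inner ℝ (v - diff x p (tangentPart x p v)) (diff x p Y) = 0 := by
  rw [diff_tangentPart h]
  exact (Submodule.mem_orthogonal' _ _).1
    (Submodule.sub_starProjection_mem_orthogonal v) _ ⟨Y, rfl⟩

theorem inner_add_of_shapeOperator {x N : M → E 5} {p : M} (h : Function.Injective (diff x p))
    {k : ℝ} {X : TangentSpace (𝓡 3) p} (hX : shapeOperator x N p X = k • X)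
    (Y : TangentSpace (𝓡 3) p) :
    inner ℝ (diff N p X + k • diff x p X) (diff x p Y) = 0 := by
  have htangent : tangentPart x p (diff N p X) = -(k • X) := by
    rw [← hX]
    simp [shapeOperator]
  have horth := inner_sub_diff_tangentPart h (diff N p X) Y
  rwa [htangent, map_neg, map_smul, sub_neg_eq_add] at horth

variable [IsManifold (𝓡 3) ∞ M]

theorem contDiffOn_comp_chart_symm {f : M → E 5} (hf : ContMDiff (𝓡 3) 𝓘(ℝ, E 5) ∞ f) (p : M) :
    ContDiffOn ℝ ∞ (f ∘ (chartAt (E 3) p).symm) (chartAt (E 3) p).target :=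
  (hf.comp_contMDiffOn (contMDiffOn_chart_symm (I := 𝓡 3))).contDiffOn

theorem fderiv_comp_chart_symm {f : M → E 5} (hf : ContMDiff (𝓡 3) 𝓘(ℝ, E 5) ∞ f) (p : M)
    {z : E 3} (hz : z ∈ (chartAt (E 3) p).target) (X : E 3) :
    fderiv ℝ (f ∘ (chartAt (E 3) p).symm) z X = diff f ((chartAt (E 3) p).symm z)
      (mfderiv (𝓡 3) (𝓡 3) (chartAt (E 3) p).symm z X) := by
  have hchart : MDifferentiableAt (𝓡 3) (𝓡 3) (chartAt (E 3) p).symm z :=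
    ((contMDiffOn_chart_symm (I := 𝓡 3) (n := ∞)).contMDiffAt
      ((chartAt (E 3) p).open_target.mem_nhds hz)).mdifferentiableAt (by simp)
  rw [← mfderiv_eq_fderiv, mfderiv_comp z ((hf _).mdifferentiableAt (by simp)) hchart]
  rfl

theorem mfderiv_chart_symm_bijective (p : M) {z : E 3} (hz : z ∈ (chartAt (E 3) p).target) :
    Function.Bijective (mfderiv (𝓡 3) (𝓡 3) (chartAt (E 3) p).symm z) := by
  have : IsManifold (𝓡 3) 1 M := IsManifold.of_le (n := ∞) (by simp)
  exact (mdifferentiable_chart (I := 𝓡 3) p).symm.mfderiv_bijective hz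

namespace IsOrientedHypersurface

variable {x N : M → E 5}

theorem isLocalHypersurface (hx : IsOrientedHypersurface x N) (p : M) :
    IsLocalHypersurface (chartAt (E 3) p).target (x ∘ (chartAt (E 3) p).symm)
      (N ∘ (chartAt (E 3) p).symm) where
  isOpen := (chartAt (E 3) p).open_target
  smooth := contDiffOn_comp_chart_symm hx.smooth p
  smooth_normal := contDiffOn_comp_chart_symm hx.smooth_normal p
  immersion z hz X Y hXY := by
    rw [fderiv_comp_chart_symm hx.smooth p hz, fderiv_comp_chart_symm hx.smooth p hz] at hXY
    exact (mfderiv_chart_symm_bijective p hz).1 (hx.immersion _ hXY)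
  mem_product _ _ := hx.mem_product _
  norm_normal _ _ := hx.norm_normal _
  normal_tangent_product _ _ := hx.normal_tangent_product _
  normal_orthogonal z hz X := by
    rw [fderiv_comp_chart_symm hx.smooth p hz]
    exact hx.normal_orthogonal _ _

theorem isPrincipalVector_comp_chart_symm (hx : IsOrientedHypersurface x N) (p : M) {z : E 3}
    (hz : z ∈ (chartAt (E 3) p).target) {k : ℝ}
    {X : TangentSpace (𝓡 3) ((chartAt (E 3) p).symm z)} (hX₀ : X ≠ 0)
    (hX : shapeOperator x N ((chartAt (E 3) p).symm z) X = k • X) {X' : E 3}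
    (hX' : mfderiv (𝓡 3) (𝓡 3) (chartAt (E 3) p).symm z X' = X) :
    IsPrincipalVector (x ∘ (chartAt (E 3) p).symm) (N ∘ (chartAt (E 3) p).symm) k z X' where
  ne_zero := by
    rintro rfl
    exact hX₀ (hX'.symm.trans (map_zero _))
  inner_eq_zero Y := by
    rw [fderiv_comp_chart_symm hx.smooth p hz, fderiv_comp_chart_symm hx.smooth p hz,
      fderiv_comp_chart_symm hx.smooth_normal p hz, hX']
    exact inner_add_of_shapeOperator (hx.immersion _) hX _

theorem exists_isPrincipalVector (hx : IsOrientedHypersurface x N) (p : M) {z : E 3}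
    (hz : z ∈ (chartAt (E 3) p).target) {k : ℝ}
    (hk : (shapeOperator x N ((chartAt (E 3) p).symm z)).HasEigenvalue k) :
    ∃ X, IsPrincipalVector (x ∘ (chartAt (E 3) p).symm) (N ∘ (chartAt (E 3) p).symm) k z X := by
  obtain ⟨X, hX⟩ := hk.exists_hasEigenvector
  obtain ⟨X', hX'⟩ : ∃ X' : E 3, _ := (mfderiv_chart_symm_bijective p hz).2 X
  exact ⟨X', hx.isPrincipalVector_comp_chart_symm p hz hX.2 hX.apply_eq_smul hX'⟩

theorem exists_isHeightVector (hx : IsOrientedHypersurface x N) (p : M) {z : E 3}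
    (hz : z ∈ (chartAt (E 3) p).target) {k : ℝ}
    (hT : heightField x ((chartAt (E 3) p).symm z) ≠ 0)
    (hST : shapeOperator x N ((chartAt (E 3) p).symm z) (heightField x ((chartAt (E 3) p).symm z)) =
      k • heightField x ((chartAt (E 3) p).symm z)) :
    ∃ T, IsHeightVector (x ∘ (chartAt (E 3) p).symm) z T ∧
      IsPrincipalVector (x ∘ (chartAt (E 3) p).symm) (N ∘ (chartAt (E 3) p).symm) k z T := by
  obtain ⟨T, hT'⟩ : ∃ T : E 3, _ :=
    (mfderiv_chart_symm_bijective p hz).2 (heightField x ((chartAt (E 3) p).symm z))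
  refine ⟨T, fun Y => ?_, hx.isPrincipalVector_comp_chart_symm p hz hT hST hT'⟩
  rw [fderiv_comp_chart_symm hx.smooth p hz, fderiv_comp_chart_symm hx.smooth p hz, hT']
  exact inner_sub_diff_tangentPart (hx.immersion _) dt _

end IsOrientedHypersurface

end Manifold

end S3R

theorem mainTheorem2 {M : Type*} [TopologicalSpace M] [ChartedSpace (S3R.E 3) M]
    [IsManifold (𝓡 3) ∞ M] (x N : M → S3R.E 5) (hx : S3R.IsOrientedHypersurface x N)
    (k₁ k₂ k₃ : M → ℝ)
    (hk₁ : ∀ p, (S3R.shapeOperator x N p).HasEigenvalue (k₁ p))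
    (hk₂ : ∀ p, (S3R.shapeOperator x N p).HasEigenvalue (k₂ p))
    (hk₃ : ∀ p, (S3R.shapeOperator x N p).HasEigenvalue (k₃ p))
    (h₁₂ : ∀ p, k₁ p ≠ k₂ p) (h₁₃ : ∀ p, k₁ p ≠ k₃ p) (h₂₃ : ∀ p, k₂ p ≠ k₃ p)
    (hT : ∀ p, S3R.heightField x p ≠ 0)
    (hST : ∀ p, S3R.shapeOperator x N p (S3R.heightField x p) = k₁ p • S3R.heightField x p)
    (f₁ f₂ : ℝ → ℝ) (hf₁ : ∀ p, k₂ p = f₁ (k₁ p)) (hf₂ : ∀ p, k₃ p = f₂ (k₁ p)) :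
    S3R.LocallyCongruentToTorusMap x := by
  intro p
  have hp := mem_chart_source (S3R.E 3) p
  have hlocal := hx.isLocalHypersurface p
  have hheight := fun z hz => hx.exists_isHeightVector p (z := z) hz (hT _) (hST _)
  set c := chartAt (S3R.E 3) p
  obtain ⟨χ, b, I, α₁, α₂, hpχ, -, hχ, hχ_symm, hb, hprofile, htorus⟩ := hlocal.exists_torus_chart
    (k₁ := k₁ ∘ c.symm) (k₂ := k₂ ∘ c.symm) (k₃ := k₃ ∘ c.symm) hheight
    (fun z hz => hx.exists_isPrincipalVector p hz (hk₂ _))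
    (fun z hz => hx.exists_isPrincipalVector p hz (hk₃ _))
    (fun z _ => h₁₂ _) (fun z _ => h₁₃ _) (fun z _ => hf₁ _) (fun z _ => hf₂ _)
    (c.map_source hp) (h₂₃ _)
  refine ⟨c.trans χ, b.repr.toAffineIsometryEquiv, I, α₁, α₂, S3R.trans_mem_maximalAtlas
    (IsManifold.chart_mem_maximalAtlas p) hχ hχ_symm, ?_, S3R.image_product_of_basis hb,
    hprofile, fun q hq => ?_⟩
  · rw [OpenPartialHomeomorph.trans_source]
    exact ⟨hp, hpχ⟩
  · rw [OpenPartialHomeomorph.trans_source] at hq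
    have hxq := htorus (c q) hq.2
    rw [Function.comp_apply, c.left_inv hq.1] at hxq
    exact hxq
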